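/- **Model.** Let $P_1,P_2$ be probability distributions on $[0,\infty)$. For positive integers $n$ and nonnegative integers $m$ let $X_1,\dots,X_m,Y_1,\dots,Y_n$ be independent random variables, each $X_i$ with distribution $P_1$ and each $Y_j$ with distribution $P_2$. Given $X=\{X_i\}$ and $Y=\{Y_j\}$, let $H_{X,Y}$ be the random bipartite graph with parts $V=\{v_1,\dots,v_n\}$ and $W=\{w_1,\dots,w_m\}$ in which the edges $\{w_i,v_j\}$ are inserted independently with probabilities $p_{ij}=\min\{1,X_iY_j(nm)^{-1/2}\}$. The inhomogeneous random intersection graph $G(P_1,P_2,n,m)$ is the graph on $V$ in which two distinct vertices are adjacent iff they have a common neighbour in $H_{X,Y}$; $d(v_1)$ denotes the degree of $v_1$ in it. Write $a_i=\mathbf{E}X_1^i$ and $b_i=\mathbf{E}Y_1^i$. **Theorem.** Let $P_1,P_2$ be fixed and let $n,m\to\infty$ (along sequences of positive integers $n=n_k$ and of nonnegative integers $m=m_k$). (i) If $m/n\to 0$ and $\mathbf{E}X_1<\infty$, then $\mathbf{P}(d(v_1)=0)\to 1$. (ii) Suppose that $m/n\to\beta$ for some $\beta\in(0,\infty)$,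 $\mathbf{E}X_1^2<\infty$ and $\mathbf{E}Y_1<\infty$. Put $\lambda_1=Y_1a_1\beta^{1/2}$, $\lambda_2=X_1b_1\beta^{-1/2}$, and let $\Lambda_1,\Lambda_2$ be random variables with $$\mathbf{P}(\Lambda_i=r)=\mathbf{E}\,e^{-\lambda_i}\frac{\lambda_i^r}{r!},\qquad r=0,1,2,\dots,\quad i=1,2.$$ Let $\tau_1,\tau_2,\dots$ be independent identically distributed random variables with values in $\{0,1,2,\dots\}$, the whole sequence being independent of $\Lambda_1$, such that $$\mathbf{P}(\tau_1=r)=\frac{r+1}{\mathbf{E}\Lambda_2}\,\mathbf{P}(\Lambda_2=r+1),\qquad r=0,1,2,\dots,$$ if $\mathbf{E}\Lambda_2>0$ (if $\mathbf{E}\Lambda_2=0$, then $\Lambda_1=0$ almost surely and the distribution of $\tau_1$ may be arbitrary). Then $d(v_1)$ converges in distribution to $$d_*=\sum_{j=1}^{\Lambda_1}\tau_j .$$ (iii) Suppose that $m/n\to\infty$, $\mathbf{E}X_1^2<\infty$ and $\mathbf{E}Y_1<\infty$. Then $d(v_1)$ converges in distribution to a random variable $\Lambda_3$ with $$\mathbf{P}(\Lambda_3=r)=\mathbf{E}\,e^{-\lambda_3}\frac{\lambda_3^r}{r!},\qquad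 r=0,1,2,\dots,\qquad \lambda_3=Y_1a_2b_1 .$$ -/

import Mathlib

open MeasureTheory ProbabilityTheory Filter Topology
open scoped NNReal ENNReal Nat

noncomputable section

namespace InhomRIG

/-- Edge probability `min {1, x y / √(n m)}` of the bipartite graph, as a point of `[0, 1]`. -/
def edgeProb (n m : ℕ) (x y : ℝ≥0) : unitInterval :=
  ⟨min 1 ((x : ℝ) * y / √((n : ℝ) * m)), le_min zero_le_one (by positivity), min_le_left _ _⟩

/-- Bipartite graphs with parts `W = Fin m` and `V = Fin n`: `h i j = true` means that
`{w_i, v_j}` is an edge. -/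
abbrev Bipartite (n m : ℕ) : Type := Fin m → Fin n → Bool

/-- Conditional law of the bipartite graph given the weights `x`, `y`: the edges are
independent and `{w_i, v_j}` is present with probability `edgeProb n m (x i) (y j)`. -/
def edgeMeasure (n m : ℕ) (x : Fin m → ℝ≥0) (y : Fin n → ℝ≥0) : Measure (Bipartite n m) :=
  Measure.pi fun i => Measure.pi fun j => bernoulliMeasure true false (edgeProb n m (x i) (y j))

instance (n m : ℕ) (x : Fin m → ℝ≥0) (y : Fin n → ℝ≥0) :
    IsProbabilityMeasure (edgeMeasure n m x y) := by
  unfold edgeMeasure; infer_instance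

theorem measurable_edgeProb (n m : ℕ) : Measurable fun z : ℝ≥0 × ℝ≥0 => edgeProb n m z.1 z.2 := by
  unfold edgeProb
  refine Measurable.subtype_mk ?_
  fun_prop

theorem measurable_bernoulli_singleton (b : Bool) :
    Measurable fun p : unitInterval => bernoulliMeasure true false p {b} := by
  simp only [bernoulliMeasure_def]
  cases b <;> simp <;> fun_prop

theorem measurable_edgeMeasure (n m : ℕ) :
    Measurable fun z : (Fin m → ℝ≥0) × (Fin n → ℝ≥0) => edgeMeasure n m z.1 z.2 := by
  refine Measure.measurable_of_measurable_coe _ fun s _ => ?_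
  have key : ∀ z : (Fin m → ℝ≥0) × (Fin n → ℝ≥0), edgeMeasure n m z.1 z.2 s =
      ∑ h ∈ s.toFinite.toFinset, ∏ i, ∏ j,
        bernoulliMeasure true false (edgeProb n m (z.1 i) (z.2 j)) {h i j} := by
    intro z
    have hs : (s.toFinite.toFinset : Set (Bipartite n m)) = s := by simp
    conv_lhs => rw [← hs, ← sum_measure_singleton]
    refine Finset.sum_congr rfl fun h _ => ?_
    simp [edgeMeasure, Measure.pi_singleton]
  simp only [key]
  refine Finset.measurable_fun_sum _ fun h _ => Finset.measurable_fun_prod _ fun i _ =>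
    Finset.measurable_fun_prod _ fun j _ => ?_
  exact (measurable_bernoulli_singleton _).comp ((measurable_edgeProb n m).comp
    (f := fun z : (Fin m → ℝ≥0) × (Fin n → ℝ≥0) => (z.1 i, z.2 j)) (by fun_prop))

/-- `edgeMeasure` as a Markov kernel from weights to bipartite graphs. -/
def edgeKernel (n m : ℕ) : Kernel ((Fin m → ℝ≥0) × (Fin n → ℝ≥0)) (Bipartite n m) :=
  ⟨fun z => edgeMeasure n m z.1 z.2, measurable_edgeMeasure n m⟩

instance (n m : ℕ) : IsMarkovKernel (edgeKernel n m) :=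
  ⟨fun z => inferInstanceAs (IsProbabilityMeasure (edgeMeasure n m z.1 z.2))⟩

/-- Sample space: the weights `(X, Y)` together with the bipartite graph `H_{X,Y}`. -/
abbrev Sample (n m : ℕ) : Type := ((Fin m → ℝ≥0) × (Fin n → ℝ≥0)) × Bipartite n m

/-- The joint law of the weights and the bipartite graph: the `X_i` have law `P₁`, the `Y_j` have
law `P₂`, all are independent, and given the weights the graph has law `edgeMeasure`. -/
def modelMeasure (P₁ P₂ : Measure ℝ≥0) (n m : ℕ) : Measure (Sample n m) :=
  ((Measure.pi fun _ : Fin m => P₁).prod (Measure.pi fun _ : Fin n => P₂)).compProd (edgeKernel n m)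

instance (P₁ P₂ : Measure ℝ≥0) [IsProbabilityMeasure P₁] [IsProbabilityMeasure P₂] (n m : ℕ) :
    IsProbabilityMeasure (modelMeasure P₁ P₂ n m) := by
  unfold modelMeasure; infer_instance

/-- The intersection graph on `V`: distinct `u`, `v` are adjacent iff they have a common
neighbour in the bipartite graph. -/
def intersectionGraph {n m : ℕ} (h : Bipartite n m) : SimpleGraph (Fin n) where
  Adj u v := u ≠ v ∧ ∃ i, h i u = true ∧ h i v = true
  symm := ⟨fun _ _ huv => ⟨huv.1.symm, huv.2.imp fun _ hi => hi.symm⟩⟩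
  loopless := ⟨fun _ hv => hv.1 rfl⟩

instance {n m : ℕ} (h : Bipartite n m) : DecidableRel (intersectionGraph h).Adj :=
  fun u v => inferInstanceAs (Decidable (u ≠ v ∧ ∃ i, h i u = true ∧ h i v = true))

/-- The degree `d(v)` of `v` in the random intersection graph, as a random variable. -/
def deg {n m : ℕ} (v : Fin n) (ω : Sample n m) : ℕ := (intersectionGraph ω.2).degree v

/-- The moment `E Z^i` of a nonnegative random variable with law `P`. -/
def rawMoment (P : Measure ℝ≥0) (i : ℕ) : ℝ := ∫ z, (z : ℝ) ^ i ∂(P)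

/-- `Λ` has the mixed Poisson distribution whose random mean is `lam Z`, with `Z` of law `P`:
`P(Λ = r) = E e^{-lam Z} (lam Z)^r / r!`. -/
structure IsMixedPoisson {Ω : Type*} [MeasurableSpace Ω] (μ : Measure Ω) (Λ : Ω → ℕ)
    (P : Measure ℝ≥0) (lam : ℝ≥0 → ℝ) : Prop where
  measurable : Measurable Λ
  prob_eq : ∀ r : ℕ, μ.real {ω | Λ ω = r} = ∫ z, Real.exp (-lam z) * lam z ^ r / (r ! : ℝ) ∂(P)

/-- `τ` has the size-biased shift of the distribution of `Λ`:
`P(τ = r) = (r + 1) / E Λ * P(Λ = r + 1)`. There is no such distribution if `E Λ = 0`;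
then the law of `τ` is left arbitrary. -/
structure IsSizeBiasedShift {Ω : Type*} [MeasurableSpace Ω] (μ : Measure Ω) (τ : Ω → ℕ)
    (Λ : Ω → ℕ) : Prop where
  measurable : Measurable τ
  prob_eq : ∫ ω, (Λ ω : ℝ) ∂μ ≠ 0 → ∀ r : ℕ,
    μ.real {ω | τ ω = r} = (r + 1) / (∫ ω, (Λ ω : ℝ) ∂μ) * μ.real {ω | Λ ω = r + 1}

end InhomRIG

end

/-! The argument runs through the generating function E z^d(v) for z in [0, 1]. Given the weights X
and the set A of neighbours of v in W, the other n - 1 vertices hit A independently, each with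
probability `hitProb` after averaging over its own weight. Hence d(v) is binomial and E z^d(v) = E
(1 - (1 - z) q)^(n-1) with q = `hitProb` (`integral_pow_deg`).

Let S be the total weight of A. Then n q is close to b₁ S n/√(nm), and the binomial is close to a
Poisson law, so the generating function is close to the Laplace transform of S at (1 - z) b₁ n/√(nm)
(`abs_integral_pow_deg_sub_nbrLaplace_le`). The error is split at a truncation level K of the scaled
weight. Above K a Markov-type bound, uniform in n and m, gives O(a₂ b₁/K); below K dominated
convergence needs only a first moment of Y.

Given Y_v = y, S is a sum of m independent contributions, so its Laplace transform is the mean over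
y of (1 - D(y))^m, where D is `laplaceDefect`. By dominated convergence, where EX² < ∞ is used, m
D(y) converges. If m/n → β, the limit is y √β E[X (1 - exp(-(1 - z) b₁ X/√β))], which is (1 - w)
λ₁(y) with w the generating function of τ, outside degenerate cases; this gives the compound law
(`integral_pow_compound`). If m/n → ∞, the inner exponential linearises and the limit is (1 - z) y
a₂ b₁, a mixed Poisson law. Polynomial approximation turns convergence of generating functions into
convergence in distribution.

If m/n → 0, the vertex already has no neighbour in W with probability tending to one
(`integral_pow_le_prob_deg_eq_zero`). -/

noncomputable section

namespace InhomRIG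

/-! ### The exact generating function of the degree -/

/-- The mass of the Bernoulli distribution with parameter `p`. -/
def bernoulliWeight (p : ℝ) (c : Bool) : ℝ := if c then p else 1 - p

theorem bernoulliWeight_nonneg {p : ℝ} (h0 : 0 ≤ p) (h1 : p ≤ 1) (c : Bool) :
    0 ≤ bernoulliWeight p c := by
  unfold bernoulliWeight; split_ifs <;> linarith

theorem bernoulliWeight_le_one {p : ℝ} (h0 : 0 ≤ p) (h1 : p ≤ 1) (c : Bool) :
    bernoulliWeight p c ≤ 1 := by
  unfold bernoulliWeight; split_ifs <;> linarith

theorem sum_prod_bernoulliWeight {ι : Type*} [Fintype ι] [DecidableEq ι] (p : ι → ℝ)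
    (g : ι → Bool → ℝ) :
    ∑ c : ι → Bool, (∏ i, bernoulliWeight (p i) (c i)) * ∏ i, g i (c i) =
      ∏ i, (p i * g i true + (1 - p i) * g i false) := by
  simp_rw [← Finset.prod_mul_distrib]
  rw [← Fintype.prod_sum (fun i b => bernoulliWeight (p i) b * g i b)]
  simp [bernoulliWeight]

theorem real_bernoulliMeasure_singleton (p : unitInterval) (c : Bool) :
    (bernoulliMeasure true false p).real {c} = bernoulliWeight p c := by
  rw [bernoulliMeasure_real_apply p (measurableSet_singleton c)]
  cases c <;> simp [bernoulliWeight]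

theorem integral_edgeMeasure {n m : ℕ} (x : Fin m → ℝ≥0) (y : Fin n → ℝ≥0)
    (f : Bipartite n m → ℝ) :
    ∫ h, f h ∂(edgeMeasure n m x y) =
      ∑ h, (∏ i, ∏ j, bernoulliWeight (edgeProb n m (x i) (y j)) (h i j)) * f h := by
  rw [integral_fintype (Integrable.of_finite)]
  refine Finset.sum_congr rfl fun h _ => ?_
  rw [smul_eq_mul]
  congr 1
  simp only [edgeMeasure, measureReal_def, Measure.pi_singleton, ENNReal.toReal_prod]
  simp only [← measureReal_def, real_bernoulliMeasure_singleton]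

/-- Independence of the columns: a function that is a product over vertices of V can be averaged one
vertex at a time. -/
theorem sum_bipartite_prod {n m : ℕ} (w : Fin m → Fin n → Bool → ℝ)
    (G : Fin n → (Fin m → Bool) → ℝ) :
    ∑ h : Bipartite n m, (∏ i, ∏ j, w i j (h i j)) * ∏ j, G j (fun i => h i j) =
      ∏ j, ∑ c : Fin m → Bool, (∏ i, w i j (c i)) * G j c := by
  rw [Fintype.prod_sum, ← (Equiv.piComm fun (_ : Fin m) (_ : Fin n) => Bool).sum_comp]
  refine Finset.sum_congr rfl fun h _ => ?_
  rw [Finset.prod_comm, ← Finset.prod_mul_distrib]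
  rfl

/-- The factor contributed by the column `c` of `j` to the generating function of the degree of
`v`, on the event that `A` is the neighbourhood of `v`. -/
def columnFactor {n m : ℕ} (z : ℝ) (v : Fin n) (A : Fin m → Bool) (j : Fin n)
    (c : Fin m → Bool) : ℝ :=
  if j = v then (if c = A then 1 else 0) else if ∃ i, A i = true ∧ c i = true then z else 1

/-- The degree couples every column to that of v. Summing over candidate neighbourhoods A decouples
them: only A equal to the column of v survives, and for that A each other column contributes its own
factor. -/
theorem pow_degree_eq {n m : ℕ} (z : ℝ) (v : Fin n) (h : Bipartite n m) :
    z ^ (intersectionGraph h).degree v =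
      ∑ A : Fin m → Bool, ∏ j, columnFactor z v A j (fun i => h i j) := by
  rw [Finset.sum_eq_single (fun i => h i v)]
  · rw [← SimpleGraph.card_neighborFinset_eq_degree, SimpleGraph.neighborFinset_eq_filter,
      ← Finset.prod_const, Finset.prod_filter]
    refine Finset.prod_congr rfl fun j _ => ?_
    by_cases hj : j = v
    · subst hj; simp [columnFactor]
    · have : v ≠ j := fun e => hj e.symm
      simp [columnFactor, hj, intersectionGraph, this]
  · intro A _ hA
    refine Finset.prod_eq_zero (Finset.mem_univ v) ?_
    simp [columnFactor, Ne.symm hA]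
  · simp

/-- The conditional probability that a vertex of weight `y` misses the set `A`. -/
def missProb (n m : ℕ) (x : Fin m → ℝ≥0) (A : Fin m → Bool) (y : ℝ≥0) : ℝ :=
  ∏ i, if A i then 1 - (edgeProb n m (x i) y : ℝ) else 1

/-- The conditional probability that the neighbourhood of a vertex of weight `y` is `A`. -/
def nbrWeight (n m : ℕ) (x : Fin m → ℝ≥0) (A : Fin m → Bool) (y : ℝ≥0) : ℝ :=
  ∏ i, bernoulliWeight (edgeProb n m (x i) y) (A i)

theorem sum_nbrWeight {n m : ℕ} (x : Fin m → ℝ≥0) (y : ℝ≥0) :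
    ∑ A : Fin m → Bool, nbrWeight n m x A y = 1 := by
  have := sum_prod_bernoulliWeight (fun i => (edgeProb n m (x i) y : ℝ)) (fun _ _ => 1)
  simpa [nbrWeight] using this

theorem sum_columnFactor {n m : ℕ} (z : ℝ) (v : Fin n) (A : Fin m → Bool) (j : Fin n)
    (x : Fin m → ℝ≥0) (y : ℝ≥0) :
    ∑ c : Fin m → Bool, nbrWeight n m x c y * columnFactor z v A j c =
      if j = v then nbrWeight n m x A y else 1 - (1 - z) * (1 - missProb n m x A y) := by
  by_cases hj : j = v
  · simp [columnFactor, hj]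
  · simp only [columnFactor, hj, if_false]
    have h2 : ∑ c : Fin m → Bool, nbrWeight n m x c y *
        (∏ i, if A i = true ∧ c i = true then (0 : ℝ) else 1) = missProb n m x A y := by
      rw [missProb]
      have := sum_prod_bernoulliWeight (fun i => (edgeProb n m (x i) y : ℝ))
        (fun i b => if A i = true ∧ b = true then (0 : ℝ) else 1)
      simp only [nbrWeight]
      refine this.trans (Finset.prod_congr rfl fun i _ => ?_)
      by_cases hA : A i = true <;> simp [hA]
    -- The factor is affine in the indicator that c misses A, and that indicator is a product over
    -- i, so independence applies to it.
    have h3 : ∀ c : Fin m → Bool, (if ∃ i, A i = true ∧ c i = true then z else 1) =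
        z + (1 - z) * (∏ i, if A i = true ∧ c i = true then (0 : ℝ) else 1) := by
      intro c
      by_cases hc : ∃ i, A i = true ∧ c i = true
      · obtain ⟨i, hi⟩ := hc
        have h0 : (∏ i, if A i = true ∧ c i = true then (0 : ℝ) else 1) = 0 :=
          Finset.prod_eq_zero (Finset.mem_univ i) (if_pos hi)
        rw [if_pos ⟨i, hi⟩, h0]
        ring
      · rw [if_neg hc, Finset.prod_eq_one]
        · ring
        · intro i _
          rw [if_neg fun hi => hc ⟨i, hi⟩]
    simp_rw [h3, mul_add, mul_left_comm _ (1 - z), Finset.sum_add_distrib, ← Finset.mul_sum,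
      ← Finset.sum_mul, sum_nbrWeight, h2]
    ring

theorem edgeProb_nonneg (n m : ℕ) (x y : ℝ≥0) : 0 ≤ (edgeProb n m x y : ℝ) :=
  (edgeProb n m x y).2.1

theorem edgeProb_le_one (n m : ℕ) (x y : ℝ≥0) : (edgeProb n m x y : ℝ) ≤ 1 :=
  (edgeProb n m x y).2.2

@[fun_prop]
theorem Measurable.edgeProb {α : Type*} [MeasurableSpace α] {n m : ℕ} {f g : α → ℝ≥0}
    (hf : Measurable f) (hg : Measurable g) :
    Measurable fun a => (InhomRIG.edgeProb n m (f a) (g a) : ℝ) :=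
  measurable_subtype_coe.comp ((measurable_edgeProb n m).comp (hf.prodMk hg))

theorem missProb_nonneg (n m : ℕ) (x : Fin m → ℝ≥0) (A : Fin m → Bool) (y : ℝ≥0) :
    0 ≤ missProb n m x A y := by
  refine Finset.prod_nonneg fun i _ => ?_
  have := edgeProb_le_one n m (x i) y
  split_ifs <;> linarith

theorem missProb_le_one (n m : ℕ) (x : Fin m → ℝ≥0) (A : Fin m → Bool) (y : ℝ≥0) :
    missProb n m x A y ≤ 1 := by
  refine Finset.prod_le_one (fun i _ => ?_) fun i _ => ?_
  · have := edgeProb_le_one n m (x i) y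
    split_ifs <;> linarith
  · have := edgeProb_nonneg n m (x i) y
    split_ifs <;> linarith

theorem nbrWeight_nonneg (n m : ℕ) (x : Fin m → ℝ≥0) (A : Fin m → Bool) (y : ℝ≥0) :
    0 ≤ nbrWeight n m x A y :=
  Finset.prod_nonneg fun _ _ =>
    bernoulliWeight_nonneg (edgeProb_nonneg _ _ _ _) (edgeProb_le_one _ _ _ _) _

theorem nbrWeight_le_one (n m : ℕ) (x : Fin m → ℝ≥0) (A : Fin m → Bool) (y : ℝ≥0) :
    nbrWeight n m x A y ≤ 1 :=
  Finset.prod_le_one (fun _ _ =>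
    bernoulliWeight_nonneg (edgeProb_nonneg _ _ _ _) (edgeProb_le_one _ _ _ _) _) fun _ _ =>
    bernoulliWeight_le_one (edgeProb_nonneg _ _ _ _) (edgeProb_le_one _ _ _ _) _

theorem measurable_missProb (n m : ℕ) (A : Fin m → Bool) :
    Measurable fun a : (Fin m → ℝ≥0) × ℝ≥0 => missProb n m a.1 A a.2 := by
  unfold missProb
  refine Finset.measurable_fun_prod _ fun i _ => ?_
  cases A i
  · simp
  · simp; fun_prop

theorem measurable_nbrWeight (n m : ℕ) (A : Fin m → Bool) :
    Measurable fun a : (Fin m → ℝ≥0) × ℝ≥0 => nbrWeight n m a.1 A a.2 := by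
  unfold nbrWeight bernoulliWeight
  refine Finset.measurable_fun_prod _ fun i _ => ?_
  cases A i <;> (simp; fun_prop)

theorem integrable_missProb (P : Measure ℝ≥0) [IsProbabilityMeasure P] (n m : ℕ)
    (x : Fin m → ℝ≥0) (A : Fin m → Bool) : Integrable (missProb n m x A) P :=
  .of_bound ((measurable_missProb n m A).comp (measurable_prodMk_left (x := x))).aestronglyMeasurable
    1 (.of_forall fun y => by
      rw [Real.norm_eq_abs, abs_of_nonneg (missProb_nonneg _ _ _ _ _)]
      exact missProb_le_one _ _ _ _ _)

theorem integrable_nbrWeight (P : Measure ℝ≥0) [IsProbabilityMeasure P] (n m : ℕ)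
    (x : Fin m → ℝ≥0) (A : Fin m → Bool) : Integrable (nbrWeight n m x A) P :=
  .of_bound ((measurable_nbrWeight n m A).comp (measurable_prodMk_left (x := x))).aestronglyMeasurable
    1 (.of_forall fun y => by
      rw [Real.norm_eq_abs, abs_of_nonneg (nbrWeight_nonneg _ _ _ _ _)]
      exact nbrWeight_le_one _ _ _ _ _)

/-- The conditional probability, given the weights `x`, that a vertex whose weight has law `P`
meets the set `A`. -/
def hitProb (P : Measure ℝ≥0) (n m : ℕ) (x : Fin m → ℝ≥0) (A : Fin m → Bool) : ℝ :=
  1 - ∫ y, missProb n m x A y ∂P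

theorem integral_pow_degree_edgeMeasure {n m : ℕ} (z : ℝ) (v : Fin n) (x : Fin m → ℝ≥0)
    (y : Fin n → ℝ≥0) :
    ∫ h, z ^ (intersectionGraph h).degree v ∂(edgeMeasure n m x y) =
      ∑ A : Fin m → Bool, ∏ j, (if j = v then nbrWeight n m x A (y j)
        else 1 - (1 - z) * (1 - missProb n m x A (y j))) := by
  rw [integral_edgeMeasure]
  simp_rw [pow_degree_eq, Finset.mul_sum]
  rw [Finset.sum_comm]
  refine Finset.sum_congr rfl fun A _ => ?_
  rw [sum_bipartite_prod (fun i j => bernoulliWeight (edgeProb n m (x i) (y j)))]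
  exact Finset.prod_congr rfl fun j _ => sum_columnFactor z v A j x (y j)

theorem measurable_deg {n m : ℕ} (v : Fin n) : Measurable (deg (m := m) v) :=
  (measurable_of_countable fun h : Bipartite n m => (intersectionGraph h).degree v).comp
    measurable_snd

/-- The probability generating function of the degree of a vertex: given the weights `x` and the
neighbourhood `A` of the vertex, the degree is binomial. -/
theorem integral_pow_deg (P₁ P₂ : Measure ℝ≥0) [IsProbabilityMeasure P₁] [IsProbabilityMeasure P₂]
    {n m : ℕ} {z : ℝ} (h0 : 0 ≤ z) (h1 : z ≤ 1) (v : Fin n) :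
    ∫ ω, z ^ deg v ω ∂(modelMeasure P₁ P₂ n m) =
      ∫ x, ∑ A : Fin m → Bool, (∫ y, nbrWeight n m x A y ∂P₂) *
        (1 - (1 - z) * hitProb P₂ n m x A) ^ (n - 1) ∂(Measure.pi fun _ : Fin m => P₁) := by
  have hint : Integrable (fun ω => z ^ deg v ω) (modelMeasure P₁ P₂ n m) := by
    refine .of_bound ((measurable_of_countable fun k : ℕ => z ^ k).comp
      (measurable_deg v)).aestronglyMeasurable 1 (.of_forall fun ω => ?_)
    rw [Real.norm_eq_abs, abs_of_nonneg (by positivity)]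
    exact pow_le_one₀ h0 h1
  rw [modelMeasure] at hint ⊢
  have hint' := ((Measure.integrable_compProd_iff hint.1).1 hint).2
  simp only [Real.norm_eq_abs, abs_of_nonneg (pow_nonneg h0 _)] at hint'
  rw [Measure.integral_compProd hint, integral_prod _ hint']
  refine integral_congr_ae (.of_forall fun x => ?_)
  change ∫ y, (∫ h, z ^ (intersectionGraph h).degree v ∂(edgeMeasure n m x y)) ∂_ = _
  simp_rw [integral_pow_degree_edgeMeasure]
  have hF : ∀ (A : Fin m → Bool) (j : Fin n), Integrable (fun y => if j = v then
      nbrWeight n m x A y else 1 - (1 - z) * (1 - missProb n m x A y)) P₂ := by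
    intro A j
    split_ifs
    · exact integrable_nbrWeight P₂ n m x A
    · exact (integrable_const 1).sub (((integrable_const 1).sub
        (integrable_missProb P₂ n m x A)).const_mul _)
  rw [integral_finsetSum _ fun A _ => Integrable.fintype_prod (hF A)]
  refine Finset.sum_congr rfl fun A _ => ?_
  rw [integral_fintype_prod_eq_prod
    (fun j y => if j = v then nbrWeight n m x A y else 1 - (1 - z) * (1 - missProb n m x A y))]
  rw [← Finset.mul_prod_erase _ _ (Finset.mem_univ v)]
  congr 1
  · simp
  · rw [Finset.prod_congr rfl (g := fun _ => 1 - (1 - z) * hitProb P₂ n m x A)]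
    · simp
    · intro j hj
      simp only [Finset.ne_of_mem_erase hj, if_false]
      have hi := integrable_missProb P₂ n m x A
      have hi' : Integrable (fun y => 1 - missProb n m x A y) P₂ := (integrable_const 1).sub hi
      rw [integral_sub (integrable_const 1) (hi'.const_mul _), integral_const_mul,
        integral_sub (integrable_const 1) hi]
      simp [hitProb]

/-! ### Binomial against Poisson: elementary inequalities -/

theorem one_sub_sum_le_prod_one_sub {ι : Type*} (s : Finset ι) (f : ι → ℝ)
    (h0 : ∀ i, 0 ≤ f i) (h1 : ∀ i, f i ≤ 1) : 1 - ∑ i ∈ s, f i ≤ ∏ i ∈ s, (1 - f i) := by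
  classical
  induction s using Finset.induction_on with
  | empty => simp
  | insert a s ha ih =>
    rw [Finset.sum_insert ha, Finset.prod_insert ha]
    have hs : ∏ i ∈ s, (1 - f i) ≤ 1 :=
      Finset.prod_le_one (fun i _ => sub_nonneg.2 (h1 i)) fun i _ => by linarith [h0 i]
    nlinarith [h0 a]

theorem pow_sub_pow_le_mul_sub {a b : ℝ} (hb : 0 ≤ b) (hba : b ≤ a) (ha : a ≤ 1) (n : ℕ) :
    a ^ n - b ^ n ≤ n * (a - b) := by
  induction n with
  | zero => simp
  | succ n ih =>
    have h1 : a ^ n ≤ 1 := pow_le_one₀ (hb.trans hba) ha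
    have h2 : b ^ n ≤ a ^ n := pow_le_pow_left₀ hb hba n
    have h3 : b * (a ^ n - b ^ n) ≤ a ^ n - b ^ n :=
      mul_le_of_le_one_left (by linarith) (hba.trans ha)
    have h4 : (a - b) * a ^ n ≤ a - b := mul_le_of_le_one_right (by linarith) h1
    push_cast
    rw [pow_succ, pow_succ]
    linarith

/-- Both terms are n-th powers of numbers in [0, 1] that differ by at most u², and the n-th power is
n-Lipschitz there. -/
theorem abs_one_sub_pow_sub_exp_le (n : ℕ) {u : ℝ} (h0 : 0 ≤ u) (h1 : u ≤ 1) :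
    |(1 - u) ^ n - Real.exp (-(n * u))| ≤ n * u ^ 2 := by
  have he : Real.exp (-(n * u)) = Real.exp (-u) ^ n := by
    rw [← Real.exp_nat_mul]; ring_nf
  have hle := Real.one_sub_le_exp_neg u
  have hsq : Real.exp (-u) - (1 - u) ≤ u ^ 2 := by
    have := (abs_le.1 (Real.abs_exp_sub_one_sub_id_le (x := -u)
      (by rw [abs_neg, abs_of_nonneg h0]; exact h1))).2
    linarith [neg_sq u]
  have hp := pow_sub_pow_le_mul_sub (by linarith : 0 ≤ 1 - u) hle
    (Real.exp_le_one_iff.2 (by linarith)) n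
  have hq : (1 - u) ^ n ≤ Real.exp (-u) ^ n := pow_le_pow_left₀ (by linarith) hle _
  have hmul : (n : ℝ) * (Real.exp (-u) - (1 - u)) ≤ n * u ^ 2 := by gcongr
  rw [he, abs_sub_comm, abs_of_nonneg (by linarith)]
  linarith

/-- There are n - 1 other vertices, while the Poisson mean is normalised by n; the missing factor
costs the extra u. -/
theorem abs_one_sub_pow_pred_sub_exp_le {n : ℕ} (hn : 0 < n) {u : ℝ} (h0 : 0 ≤ u) (h1 : u ≤ 1) :
    |(1 - u) ^ (n - 1) - Real.exp (-(n * u))| ≤ u + n * u ^ 2 := by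
  have h2 := abs_le.1 (abs_one_sub_pow_sub_exp_le n h0 h1)
  have hr : (1 - u) ^ (n - 1) ≤ 1 := pow_le_one₀ (by linarith) (by linarith)
  have hr0 : 0 ≤ (1 - u) ^ (n - 1) := pow_nonneg (by linarith) _
  have hur : u * (1 - u) ^ (n - 1) ≤ u := mul_le_of_le_one_right h0 hr
  have hur0 : 0 ≤ u * (1 - u) ^ (n - 1) := mul_nonneg h0 hr0
  have hs : (1 - u) ^ n = (1 - u) ^ (n - 1) - u * (1 - u) ^ (n - 1) := by
    obtain ⟨k, rfl⟩ : ∃ k, n = k + 1 := ⟨n - 1, by omega⟩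
    rw [Nat.add_sub_cancel]; ring
  rw [abs_le]
  constructor <;> linarith [h2.1, h2.2]

theorem abs_exp_neg_sub_exp_neg_le {a b : ℝ} (ha : 0 ≤ a) (hab : a ≤ b) :
    |Real.exp (-a) - Real.exp (-b)| ≤ b - a := by
  have h1 : Real.exp (-b) ≤ Real.exp (-a) := Real.exp_le_exp.2 (by linarith)
  have h2 : Real.exp (-b) = Real.exp (-a) * Real.exp (-(b - a)) := by
    rw [← Real.exp_add]; ring_nf
  have h3 := Real.one_sub_le_exp_neg (b - a)
  have h4 : Real.exp (-a) ≤ 1 := Real.exp_le_one_iff.2 (by linarith)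
  have h5 := Real.exp_pos (-a)
  rw [abs_of_nonneg (by linarith), h2]
  nlinarith

/-! ### The linearisation defect -/

/-- The defect `v - c (1 - e^{-v/c})` of the linear approximation of `c (1 - e^{-v/c})`. -/
def expDefect (c v : ℝ) : ℝ := v - c * (1 - Real.exp (-(v / c)))

theorem expDefect_mono {c : ℝ} (hc : 0 < c) {v w : ℝ} (hv : 0 ≤ v) (hvw : v ≤ w) :
    expDefect c v ≤ expDefect c w := by
  have h := abs_exp_neg_sub_exp_neg_le (div_nonneg hv hc.le) (div_le_div_of_nonneg_right hvw hc.le)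
  have h' := mul_le_mul_of_nonneg_left (le_of_abs_le h) hc.le
  have : c * (w / c - v / c) = w - v := by field_simp
  unfold expDefect
  linarith

theorem expDefect_nonneg {c : ℝ} (hc : 0 < c) {v : ℝ} (hv : 0 ≤ v) : 0 ≤ expDefect c v := by
  have := expDefect_mono hc le_rfl hv
  simpa [expDefect] using this

theorem expDefect_le {c : ℝ} (hc : 0 < c) {v : ℝ} (hv : 0 ≤ v) : expDefect c v ≤ v := by
  have : Real.exp (-(v / c)) ≤ 1 := Real.exp_le_one_iff.2 (by have := div_nonneg hv hc.le; linarith)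
  unfold expDefect
  nlinarith

theorem expDefect_le_sq_div {c : ℝ} (hc : 0 < c) {v : ℝ} (hv : 0 ≤ v) (hvc : v ≤ c) :
    expDefect c v ≤ v ^ 2 / c := by
  have h0 := div_nonneg hv hc.le
  have := (abs_le.1 (Real.abs_exp_sub_one_sub_id_le (x := -(v / c))
      (by rw [abs_neg, abs_of_nonneg h0]; exact (div_le_one hc).2 hvc))).2
  have h2 := mul_le_mul_of_nonneg_left this hc.le
  have e1 : c * (Real.exp (-(v / c)) - 1 - -(v / c)) = expDefect c v := by
    unfold expDefect; field_simp; ring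
  have e2 : c * (-(v / c)) ^ 2 = v ^ 2 / c := by field_simp
  rwa [e1, e2] at h2

theorem measurable_expDefect (c : ℝ) : Measurable (expDefect c) := by
  unfold expDefect; fun_prop

/-- A quadratic bound on the defect would require a second moment of P. It is used only pointwise in
y; the bound yK dominates, so a first moment suffices. -/
theorem tendsto_integral_expDefect (P : Measure ℝ≥0) [IsProbabilityMeasure P]
    (hP : Integrable (fun y : ℝ≥0 => (y : ℝ)) P) {n : ℕ → ℕ} (hn : Tendsto n atTop atTop)
    {K : ℝ} (hK : 0 ≤ K) :
    Tendsto (fun k => ∫ y, expDefect (n k) (y * K) ∂P) atTop (𝓝 0) := by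
  have h := tendsto_integral_filter_of_dominated_convergence (μ := P) (l := atTop)
    (F := fun k (y : ℝ≥0) => expDefect (n k) (y * K)) (f := fun _ => 0)
    (fun y => (y : ℝ) * K) ?_ ?_ (hP.mul_const K) ?_
  · simpa using h
  · exact .of_forall fun k => ((measurable_expDefect _).comp (by fun_prop)).aestronglyMeasurable
  · filter_upwards [hn.eventually_gt_atTop 0] with k hk
    refine .of_forall fun y => ?_
    have hk' : (0 : ℝ) < n k := by exact_mod_cast hk
    have hy : (0 : ℝ) ≤ y * K := by positivity
    rw [Real.norm_eq_abs, abs_of_nonneg (expDefect_nonneg hk' hy)]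
    exact expDefect_le hk' hy
  · refine .of_forall fun y => ?_
    have hn' : Tendsto (fun k => (n k : ℝ)) atTop atTop := tendsto_natCast_atTop_atTop.comp hn
    have hy : (0 : ℝ) ≤ y * K := by positivity
    refine tendsto_of_tendsto_of_tendsto_of_le_of_le' tendsto_const_nhds
      (hn'.const_div_atTop (((y : ℝ) * K) ^ 2)) ?_ ?_
    · filter_upwards [hn'.eventually_gt_atTop 0] with k hk using expDefect_nonneg hk hy
    · filter_upwards [hn'.eventually_gt_atTop 0, hn'.eventually_ge_atTop (y * K)] with k hk hk'
      exact expDefect_le_sq_div hk hy hk'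

/-! ### Hitting probabilities in terms of the weight of the neighbourhood -/

/-- The total weight of the set `A`. -/
def setWeight {m : ℕ} (x : Fin m → ℝ≥0) (A : Fin m → Bool) : ℝ :=
  ∑ i, if A i then (x i : ℝ) else 0

theorem setWeight_nonneg {m : ℕ} (x : Fin m → ℝ≥0) (A : Fin m → Bool) : 0 ≤ setWeight x A :=
  Finset.sum_nonneg fun i _ => by split_ifs <;> positivity

theorem edgeProb_le (n m : ℕ) (x y : ℝ≥0) : (edgeProb n m x y : ℝ) ≤ x * y / √((n : ℝ) * m) :=
  min_le_right _ _

/-- Truncating the edge probability at 1 is harmless in this direction: where it acts, the left side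
is 0. -/
theorem one_sub_edgeProb_le_exp (n m : ℕ) (x y : ℝ≥0) :
    1 - (edgeProb n m x y : ℝ) ≤ Real.exp (-(x * y / √((n : ℝ) * m))) := by
  change 1 - min 1 ((x : ℝ) * y / √((n : ℝ) * m)) ≤ _
  rcases min_cases 1 ((x : ℝ) * y / √((n : ℝ) * m)) with h | h
  · rw [h.1]; simpa using (Real.exp_pos _).le
  · rw [h.1]; exact Real.one_sub_le_exp_neg _

theorem missProb_le_exp {n m : ℕ} (x : Fin m → ℝ≥0) (A : Fin m → Bool) (y : ℝ≥0) :
    missProb n m x A y ≤ Real.exp (-(y * (setWeight x A / √((n : ℝ) * m)))) := by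
  have e : -((y : ℝ) * (setWeight x A / √((n : ℝ) * m))) =
      ∑ i, -(if A i then (x i : ℝ) * y / √((n : ℝ) * m) else 0) := by
    rw [setWeight, Finset.sum_neg_distrib, Finset.sum_div, Finset.mul_sum]
    congr 1
    refine Finset.sum_congr rfl fun i _ => ?_
    split_ifs <;> ring
  rw [e, Real.exp_sum]
  refine Finset.prod_le_prod (fun i _ => ?_) fun i _ => ?_
  · have := edgeProb_le_one n m (x i) y
    split_ifs <;> linarith
  · split_ifs
    · exact one_sub_edgeProb_le_exp _ _ _ _
    · simp

theorem one_sub_missProb_le {n m : ℕ} (x : Fin m → ℝ≥0) (A : Fin m → Bool) (y : ℝ≥0) :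
    1 - missProb n m x A y ≤ y * (setWeight x A / √((n : ℝ) * m)) := by
  have h := one_sub_sum_le_prod_one_sub Finset.univ
    (fun i => if A i then (edgeProb n m (x i) y : ℝ) else 0)
    (fun i => by have := edgeProb_nonneg n m (x i) y; split_ifs <;> linarith)
    (fun i => by have := edgeProb_le_one n m (x i) y; split_ifs <;> linarith)
  have e : ∏ i, (1 - if A i then (edgeProb n m (x i) y : ℝ) else 0) = missProb n m x A y := by
    refine Finset.prod_congr rfl fun i _ => ?_
    split_ifs <;> ring
  have h' : ∑ i, (if A i then (edgeProb n m (x i) y : ℝ) else 0) ≤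
      y * (setWeight x A / √((n : ℝ) * m)) := by
    rw [setWeight, Finset.sum_div, Finset.mul_sum]
    refine Finset.sum_le_sum fun i _ => ?_
    split_ifs
    · exact (edgeProb_le n m (x i) y).trans_eq (by ring)
    · simp
  rw [e] at h
  linarith

theorem hitProb_nonneg (P : Measure ℝ≥0) [IsProbabilityMeasure P] {n m : ℕ} (x : Fin m → ℝ≥0)
    (A : Fin m → Bool) : 0 ≤ hitProb P n m x A := by
  have := integral_mono (integrable_missProb P n m x A) (integrable_const 1)
    (fun y => missProb_le_one n m x A y)
  simp at this
  unfold hitProb; linarith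

theorem hitProb_le_one (P : Measure ℝ≥0) {n m : ℕ} (x : Fin m → ℝ≥0)
    (A : Fin m → Bool) : hitProb P n m x A ≤ 1 := by
  have : 0 ≤ ∫ y, missProb n m x A y ∂P := integral_nonneg fun y => missProb_nonneg n m x A y
  unfold hitProb; linarith

theorem hitProb_eq_integral (P : Measure ℝ≥0) [IsProbabilityMeasure P] {n m : ℕ}
    (x : Fin m → ℝ≥0) (A : Fin m → Bool) :
    hitProb P n m x A = ∫ y, (1 - missProb n m x A y) ∂P := by
  rw [integral_sub (integrable_const 1) (integrable_missProb P n m x A)]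
  simp [hitProb]

theorem hitProb_le (P : Measure ℝ≥0) [IsProbabilityMeasure P]
    (hP : Integrable (fun y : ℝ≥0 => (y : ℝ)) P) {n m : ℕ} (x : Fin m → ℝ≥0)
    (A : Fin m → Bool) :
    hitProb P n m x A ≤ rawMoment P 1 * (setWeight x A / √((n : ℝ) * m)) := by
  rw [hitProb_eq_integral, rawMoment, ← integral_mul_const]
  refine integral_mono ((integrable_const 1).sub (integrable_missProb P n m x A)) ?_ fun y => ?_
  · simpa using hP.mul_const _
  · simpa using one_sub_missProb_le x A y

/-- Complements the union bound `hitProb_le`: together they confine n q to an interval below its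
linear approximation, with length controlled by `expDefect`. -/
theorem linear_sub_hitProb_le (P : Measure ℝ≥0) [IsProbabilityMeasure P]
    (hP : Integrable (fun y : ℝ≥0 => (y : ℝ)) P) {n m : ℕ} (hn : 0 < n) (x : Fin m → ℝ≥0)
    (A : Fin m → Bool) :
    rawMoment P 1 * (n * (setWeight x A / √((n : ℝ) * m))) - n * hitProb P n m x A ≤
      ∫ y, expDefect n (y * (n * (setWeight x A / √((n : ℝ) * m)))) ∂P := by
  have hn' : (0 : ℝ) < n := by exact_mod_cast hn
  set θ := setWeight x A / √((n : ℝ) * m) with hθ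
  have hθ0 : 0 ≤ θ := div_nonneg (setWeight_nonneg x A) (Real.sqrt_nonneg _)
  have hi : Integrable (fun y => 1 - missProb n m x A y) P :=
    (integrable_const 1).sub (integrable_missProb P n m x A)
  rw [hitProb_eq_integral, rawMoment, ← integral_mul_const, ← integral_const_mul]
  simp only [pow_one]
  rw [← integral_sub (hP.mul_const _) (hi.const_mul _)]
  refine integral_mono ((hP.mul_const _).sub (hi.const_mul _)) ?_ fun y => ?_
  · refine (hP.mul_const (n * θ)).mono'
      ((measurable_expDefect _).comp (by fun_prop)).aestronglyMeasurable (.of_forall fun y => ?_)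
    have hy : (0 : ℝ) ≤ y * (n * θ) := by positivity
    rw [Real.norm_eq_abs, abs_of_nonneg (expDefect_nonneg hn' hy)]
    exact expDefect_le hn' hy
  · have h := missProb_le_exp (n := n) x A y
    rw [← hθ] at h
    have e : (y : ℝ) * (n * θ) / n = y * θ := by field_simp
    simp only [expDefect, e]
    gcongr

/-! ### The Laplace transform of the neighbourhood weight -/

theorem sum_nbrWeight_mul_exp {n m : ℕ} (x : Fin m → ℝ≥0) (y : ℝ≥0) (t : ℝ) :
    ∑ A : Fin m → Bool, nbrWeight n m x A y * Real.exp (-(t * setWeight x A)) =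
      ∏ i, (1 - (edgeProb n m (x i) y : ℝ) * (1 - Real.exp (-(t * x i)))) := by
  have h := sum_prod_bernoulliWeight (fun i => (edgeProb n m (x i) y : ℝ))
    (fun i b => if b then Real.exp (-(t * x i)) else 1)
  have e : ∀ A : Fin m → Bool, Real.exp (-(t * setWeight x A)) =
      ∏ i, if A i then Real.exp (-(t * x i)) else 1 := by
    intro A
    rw [setWeight, Finset.mul_sum, ← Finset.sum_neg_distrib, Real.exp_sum]
    refine Finset.prod_congr rfl fun i _ => ?_
    split_ifs <;> simp
  simp_rw [e, nbrWeight]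
  refine h.trans (Finset.prod_congr rfl fun i _ => ?_)
  simp only [if_true, Bool.false_eq_true, if_false]
  ring

/-- The conditional probability of being the neighbourhood of a vertex, averaged over the weight
of the vertex. -/
def meanNbrWeight (P : Measure ℝ≥0) (n m : ℕ) (x : Fin m → ℝ≥0) (A : Fin m → Bool) : ℝ :=
  ∫ y, nbrWeight n m x A y ∂P

theorem meanNbrWeight_nonneg (P : Measure ℝ≥0) {n m : ℕ} (x : Fin m → ℝ≥0) (A : Fin m → Bool) :
    0 ≤ meanNbrWeight P n m x A :=
  integral_nonneg fun y => nbrWeight_nonneg n m x A y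

theorem sum_meanNbrWeight (P : Measure ℝ≥0) [IsProbabilityMeasure P] {n m : ℕ}
    (x : Fin m → ℝ≥0) : ∑ A : Fin m → Bool, meanNbrWeight P n m x A = 1 := by
  simp only [meanNbrWeight]
  rw [← integral_finsetSum _ fun A _ => integrable_nbrWeight P n m x A]
  simp [sum_nbrWeight]

theorem measurable_meanNbrWeight (P : Measure ℝ≥0) [IsProbabilityMeasure P] (n m : ℕ)
    (A : Fin m → Bool) : Measurable fun x => meanNbrWeight P n m x A :=
  (measurable_nbrWeight n m A).stronglyMeasurable.integral_prod_right'.measurable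

theorem measurable_hitProb (P : Measure ℝ≥0) [IsProbabilityMeasure P] (n m : ℕ)
    (A : Fin m → Bool) : Measurable fun x => hitProb P n m x A :=
  measurable_const.sub (measurable_missProb n m A).stronglyMeasurable.integral_prod_right'.measurable

theorem measurable_setWeight {m : ℕ} (A : Fin m → Bool) :
    Measurable fun x : Fin m → ℝ≥0 => setWeight x A := by
  unfold setWeight
  refine Finset.measurable_fun_sum _ fun i _ => ?_
  split_ifs <;> fun_prop

theorem integrable_sum_meanNbrWeight_mul (P₁ P₂ : Measure ℝ≥0) [IsProbabilityMeasure P₁]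
    [IsProbabilityMeasure P₂] {n m : ℕ} (g : (Fin m → ℝ≥0) → (Fin m → Bool) → ℝ)
    (hg : ∀ A, Measurable fun x => g x A) (h0 : ∀ x A, 0 ≤ g x A) (h1 : ∀ x A, g x A ≤ 1) :
    Integrable (fun x => ∑ A : Fin m → Bool, meanNbrWeight P₂ n m x A * g x A)
      (Measure.pi fun _ : Fin m => P₁) := by
  refine .of_bound (Finset.measurable_fun_sum _ fun A _ =>
    (measurable_meanNbrWeight P₂ n m A).mul (hg A)).aestronglyMeasurable 1 (.of_forall fun x => ?_)
  rw [Real.norm_eq_abs, abs_of_nonneg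
    (Finset.sum_nonneg fun A _ => mul_nonneg (meanNbrWeight_nonneg P₂ x A) (h0 x A)),
    ← sum_meanNbrWeight P₂ (n := n) x]
  exact Finset.sum_le_sum fun A _ =>
    mul_le_of_le_one_right (meanNbrWeight_nonneg P₂ x A) (h1 x A)

/-- One minus the Laplace transform at `t` of the contribution of a single `w ∈ W` to the total
weight of the neighbourhood of a vertex of weight `y`. -/
def laplaceDefect (P : Measure ℝ≥0) (n m : ℕ) (t : ℝ) (y : ℝ≥0) : ℝ :=
  ∫ x, (edgeProb n m x y : ℝ) * (1 - Real.exp (-(t * x))) ∂P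

/-- The Laplace transform of the total weight of the neighbourhood of a vertex. -/
def nbrLaplace (P₁ P₂ : Measure ℝ≥0) (n m : ℕ) (t : ℝ) : ℝ :=
  ∫ y, (1 - laplaceDefect P₁ n m t y) ^ m ∂P₂

theorem one_sub_exp_nonneg {v : ℝ} (hv : 0 ≤ v) : 0 ≤ 1 - Real.exp (-v) :=
  sub_nonneg.2 (Real.exp_le_one_iff.2 (by linarith))

theorem edgeProb_mul_nonneg {n m : ℕ} {t : ℝ} (ht : 0 ≤ t) (x y : ℝ≥0) :
    0 ≤ (edgeProb n m x y : ℝ) * (1 - Real.exp (-(t * x))) :=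
  mul_nonneg (edgeProb_nonneg n m x y) (one_sub_exp_nonneg (by positivity))

theorem edgeProb_mul_le_one {n m : ℕ} {t : ℝ} (ht : 0 ≤ t) (x y : ℝ≥0) :
    (edgeProb n m x y : ℝ) * (1 - Real.exp (-(t * x))) ≤ 1 :=
  mul_le_one₀ (edgeProb_le_one n m x y) (one_sub_exp_nonneg (by positivity))
    (by linarith [Real.exp_pos (-(t * x))])

theorem integrable_edgeProb_mul (P : Measure ℝ≥0) [IsProbabilityMeasure P] {n m : ℕ} {t : ℝ}
    (ht : 0 ≤ t) (y : ℝ≥0) :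
    Integrable (fun x : ℝ≥0 => (edgeProb n m x y : ℝ) * (1 - Real.exp (-(t * x)))) P :=
  .of_bound (by fun_prop) 1 (.of_forall fun x => by
    rw [Real.norm_eq_abs, abs_of_nonneg (edgeProb_mul_nonneg ht x y)]
    exact edgeProb_mul_le_one ht x y)

theorem laplaceDefect_nonneg (P : Measure ℝ≥0) {n m : ℕ} {t : ℝ} (ht : 0 ≤ t) (y : ℝ≥0) :
    0 ≤ laplaceDefect P n m t y :=
  integral_nonneg fun x => edgeProb_mul_nonneg ht x y

theorem laplaceDefect_le_one (P : Measure ℝ≥0) [IsProbabilityMeasure P] {n m : ℕ} {t : ℝ}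
    (ht : 0 ≤ t) (y : ℝ≥0) : laplaceDefect P n m t y ≤ 1 := by
  have := integral_mono (integrable_edgeProb_mul P (n := n) (m := m) ht y) (integrable_const 1)
    (fun x => edgeProb_mul_le_one ht x y)
  simpa [laplaceDefect] using this

/-- By Fubini the weight y of the vertex may be fixed first. The m elements of W then contribute
independent, identically distributed factors, which produces the m-th power in `nbrLaplace`. -/
theorem integral_sum_meanNbrWeight_mul_exp (P₁ P₂ : Measure ℝ≥0) [IsProbabilityMeasure P₁]
    [IsProbabilityMeasure P₂] {n m : ℕ} {t : ℝ} (ht : 0 ≤ t) :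
    ∫ x, ∑ A : Fin m → Bool, meanNbrWeight P₂ n m x A * Real.exp (-(t * setWeight x A))
      ∂(Measure.pi fun _ : Fin m => P₁) = nbrLaplace P₁ P₂ n m t := by
  have hH : Integrable (fun a : (Fin m → ℝ≥0) × ℝ≥0 =>
      ∏ i, (1 - (edgeProb n m (a.1 i) a.2 : ℝ) * (1 - Real.exp (-(t * a.1 i)))))
      ((Measure.pi fun _ : Fin m => P₁).prod P₂) := by
    refine .of_bound (Finset.measurable_fun_prod _ fun i _ => ?_).aestronglyMeasurable 1
      (.of_forall fun a => ?_)
    · fun_prop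
    · have h0 : ∀ i, 0 ≤ 1 - (edgeProb n m (a.1 i) a.2 : ℝ) * (1 - Real.exp (-(t * a.1 i))) :=
        fun i => sub_nonneg.2 (edgeProb_mul_le_one ht _ _)
      rw [Real.norm_eq_abs, abs_of_nonneg (Finset.prod_nonneg fun i _ => h0 i)]
      exact Finset.prod_le_one (fun i _ => h0 i) fun i _ => by
        linarith [edgeProb_mul_nonneg (n := n) (m := m) ht (a.1 i) a.2]
  have h1 : ∀ x : Fin m → ℝ≥0,
      ∑ A : Fin m → Bool, meanNbrWeight P₂ n m x A * Real.exp (-(t * setWeight x A)) =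
        ∫ y, ∏ i, (1 - (edgeProb n m (x i) y : ℝ) * (1 - Real.exp (-(t * x i)))) ∂P₂ := by
    intro x
    simp_rw [← sum_nbrWeight_mul_exp]
    rw [integral_finsetSum _ fun A _ => (integrable_nbrWeight P₂ n m x A).mul_const _]
    simp_rw [integral_mul_const, meanNbrWeight]
  simp_rw [h1]
  rw [integral_integral_swap hH, nbrLaplace]
  refine integral_congr_ae (.of_forall fun y => ?_)
  change ∫ x : Fin m → ℝ≥0, ∏ i, (1 - (edgeProb n m (x i) y : ℝ) *
    (1 - Real.exp (-(t * x i)))) ∂(Measure.pi fun _ : Fin m => P₁) = _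
  rw [integral_fintype_prod_eq_prod (fun (_ : Fin m) (x : ℝ≥0) => 1 - (edgeProb n m x y : ℝ) *
    (1 - Real.exp (-(t * x))))]
  simp [integral_sub (integrable_const 1) (integrable_edgeProb_mul P₁ ht y), laplaceDefect]

/-! ### Comparison of the generating function with the Laplace transform -/

/-- The tail error is written as 2 (1 - e^{-S/K}), with S the scaled weight, rather than as an
indicator of S > K, so that averaging over A and x turns it into a value of `nbrLaplace`. -/
theorem abs_binomial_sub_poisson_le (P : Measure ℝ≥0) [IsProbabilityMeasure P]
    (hP : Integrable (fun y : ℝ≥0 => (y : ℝ)) P) {n m : ℕ} (hn : 0 < n) {s K : ℝ}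
    (hs0 : 0 ≤ s) (hs1 : s ≤ 1) (hK : 0 < K) (x : Fin m → ℝ≥0) (A : Fin m → Bool) :
    |(1 - s * hitProb P n m x A) ^ (n - 1) -
        Real.exp (-(s * rawMoment P 1 * (n / √((n : ℝ) * m)) * setWeight x A))| ≤
      (rawMoment P 1 * K / n + (rawMoment P 1 * K) ^ 2 / n + ∫ y, expDefect n (y * K) ∂P) +
        2 * (1 - Real.exp (-(n / √((n : ℝ) * m) / K * setWeight x A))) := by
  have hn' : (0 : ℝ) < n := by exact_mod_cast hn
  set b := rawMoment P 1 with hb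
  set q := hitProb P n m x A with hq
  set S := n * (setWeight x A / √((n : ℝ) * m)) with hS
  have hb0 : 0 ≤ b := integral_nonneg fun y => by positivity
  have hS0 : 0 ≤ S := mul_nonneg hn'.le (div_nonneg (setWeight_nonneg x A) (Real.sqrt_nonneg _))
  have hq0 : 0 ≤ q := hitProb_nonneg P x A
  have hq1 : q ≤ 1 := hitProb_le_one P x A
  have hqS : n * q ≤ b * S := by
    have := mul_le_mul_of_nonneg_left (hitProb_le P hP (n := n) x A) hn'.le
    rw [hS]; linarith
  have hlow : b * S - n * q ≤ ∫ y, expDefect n (y * S) ∂P := linear_sub_hitProb_le P hP hn x A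
  have e1 : s * b * (n / √((n : ℝ) * m)) * setWeight x A = s * (b * S) := by rw [hS]; ring
  have e2 : (n : ℝ) / √((n : ℝ) * m) / K * setWeight x A = S / K := by rw [hS]; ring
  rw [e1, e2]
  have hsq0 : 0 ≤ s * q := mul_nonneg hs0 hq0
  have hsq1 : s * q ≤ 1 := mul_le_one₀ hs1 hq0 hq1
  have hdef : ∀ T : ℝ, 0 ≤ T → Integrable (fun y : ℝ≥0 => expDefect n (y * T)) P := by
    intro T hT
    refine (hP.mul_const T).mono'
      ((measurable_expDefect _).comp (by fun_prop)).aestronglyMeasurable (.of_forall fun y => ?_)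
    have hy : (0 : ℝ) ≤ y * T := by positivity
    rw [Real.norm_eq_abs, abs_of_nonneg (expDefect_nonneg hn' hy)]
    exact expDefect_le hn' hy
  have hdef0 : 0 ≤ ∫ y, expDefect n (y * K) ∂P :=
    integral_nonneg fun y => expDefect_nonneg hn' (by positivity)
  have hexp0 : 0 ≤ 1 - Real.exp (-(S / K)) := one_sub_exp_nonneg (by positivity)
  -- For S ≥ K the left side is at most 1, and e^{-1} < 1/2 makes the tail term at least 1. For S ≤
  -- K the success probability is at most bK/n, and the linearisation defect is at most its value at
  -- K.
  rcases le_total K S with hKS | hSK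
  · have h1 : (1 - s * q) ^ (n - 1) ≤ 1 := pow_le_one₀ (by linarith) (by linarith)
    have h0 : 0 ≤ (1 - s * q) ^ (n - 1) := pow_nonneg (by linarith) _
    have h3 : Real.exp (-(s * (b * S))) ≤ 1 := Real.exp_le_one_iff.2 (by
      have : 0 ≤ s * (b * S) := by positivity
      linarith)
    have h4 := Real.exp_pos (-(s * (b * S)))
    have h5 : Real.exp (-(S / K)) ≤ 1 / 2 := by
      have h6 : Real.exp (-(S / K)) ≤ Real.exp (-1) :=
        Real.exp_le_exp.2 (neg_le_neg ((one_le_div hK).2 hKS))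
      exact h6.trans (by linarith [Real.exp_neg_one_lt_half])
    have h7 : 0 ≤ b * K / n + (b * K) ^ 2 / n := by positivity
    rw [abs_le]
    constructor <;> linarith
  · have h1 := abs_one_sub_pow_pred_sub_exp_le hn hsq0 hsq1
    have h2 := abs_exp_neg_sub_exp_neg_le (a := n * (s * q)) (b := s * (b * S)) (by positivity)
      (by nlinarith)
    have h3 : s * (b * S) - n * (s * q) ≤ ∫ y, expDefect n (y * K) ∂P := by
      have h4 : ∫ y, expDefect n (y * S) ∂P ≤ ∫ y, expDefect n (y * K) ∂P :=
        integral_mono (hdef S hS0) (hdef K hK.le) fun y =>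
          expDefect_mono hn' (by positivity) (by gcongr)
      have h5 : s * (b * S - n * q) ≤ b * S - n * q := mul_le_of_le_one_left (by linarith) hs1
      linarith
    have hq' : s * q ≤ b * K / n := by
      rw [le_div_iff₀ hn']
      have : s * q ≤ q := mul_le_of_le_one_left hq0 hs1
      nlinarith
    have h6 : n * (s * q) ^ 2 ≤ (b * K) ^ 2 / n := by
      have : n * (s * q) ^ 2 ≤ n * (b * K / n) ^ 2 := by gcongr
      refine this.trans_eq ?_
      field_simp
    have h7 := abs_sub_le ((1 - s * q) ^ (n - 1)) (Real.exp (-(n * (s * q))))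
      (Real.exp (-(s * (b * S))))
    linarith

/-- The generating function of the degree is close to a Laplace transform of the total weight of
the neighbourhood. -/
theorem abs_integral_pow_deg_sub_nbrLaplace_le (P₁ P₂ : Measure ℝ≥0) [IsProbabilityMeasure P₁]
    [IsProbabilityMeasure P₂] (hP : Integrable (fun y : ℝ≥0 => (y : ℝ)) P₂) {n m : ℕ} (v : Fin n)
    {z K : ℝ} (h0 : 0 ≤ z) (h1 : z ≤ 1) (hK : 0 < K) :
    |∫ ω, z ^ deg v ω ∂(modelMeasure P₁ P₂ n m) -
        nbrLaplace P₁ P₂ n m ((1 - z) * rawMoment P₂ 1 * (n / √((n : ℝ) * m)))| ≤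
      (rawMoment P₂ 1 * K / n + (rawMoment P₂ 1 * K) ^ 2 / n + ∫ y, expDefect n (y * K) ∂P₂) +
        2 * (1 - nbrLaplace P₁ P₂ n m (n / √((n : ℝ) * m) / K)) := by
  have hn : 0 < n := v.pos
  have hb0 : 0 ≤ rawMoment P₂ 1 := integral_nonneg fun y => by positivity
  have hz : 0 ≤ 1 - z := by linarith
  have ht1 : 0 ≤ (1 - z) * rawMoment P₂ 1 * (n / √((n : ℝ) * m)) := by positivity
  have ht2 : 0 ≤ (n : ℝ) / √((n : ℝ) * m) / K := by positivity
  set δ := rawMoment P₂ 1 * K / n + (rawMoment P₂ 1 * K) ^ 2 / n + ∫ y, expDefect n (y * K) ∂P₂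
    with hδ
  rw [integral_pow_deg P₁ P₂ h0 h1, ← integral_sum_meanNbrWeight_mul_exp P₁ P₂ ht1,
    ← integral_sum_meanNbrWeight_mul_exp P₁ P₂ ht2]
  have hexp : ∀ t : ℝ, 0 ≤ t → Integrable (fun x => ∑ A : Fin m → Bool,
      meanNbrWeight P₂ n m x A * Real.exp (-(t * setWeight x A)))
      (Measure.pi fun _ : Fin m => P₁) := by
    intro t ht
    refine integrable_sum_meanNbrWeight_mul P₁ P₂ _ (fun A => ?_) (fun x A => (Real.exp_pos _).le)
      fun x A => Real.exp_le_one_iff.2 ?_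
    · have := measurable_setWeight A
      fun_prop
    · have := mul_nonneg ht (setWeight_nonneg x A)
      linarith
  have hpow : Integrable (fun x => ∑ A : Fin m → Bool,
      meanNbrWeight P₂ n m x A * (1 - (1 - z) * hitProb P₂ n m x A) ^ (n - 1))
      (Measure.pi fun _ : Fin m => P₁) := by
    have hle : ∀ x A, (1 - z) * hitProb P₂ n m x A ≤ 1 := fun x A =>
      mul_le_one₀ (by linarith) (hitProb_nonneg P₂ x A) (hitProb_le_one P₂ x A)
    refine integrable_sum_meanNbrWeight_mul P₁ P₂ _ (fun A => ?_)
      (fun x A => pow_nonneg (by linarith [hle x A]) _)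
      fun x A => pow_le_one₀ (by linarith [hle x A]) ?_
    · have := measurable_hitProb P₂ n m A
      fun_prop
    · have := mul_nonneg hz (hitProb_nonneg P₂ x A (n := n))
      linarith
  change |∫ x, ∑ A : Fin m → Bool, meanNbrWeight P₂ n m x A *
    (1 - (1 - z) * hitProb P₂ n m x A) ^ (n - 1) ∂(Measure.pi fun _ : Fin m => P₁) - _| ≤ _
  rw [← integral_sub hpow (hexp _ ht1)]
  refine (abs_integral_le_integral_abs).trans ?_
  have hone : Integrable (fun x => 1 - ∑ A : Fin m → Bool, meanNbrWeight P₂ n m x A *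
      Real.exp (-(n / √((n : ℝ) * m) / K * setWeight x A))) (Measure.pi fun _ : Fin m => P₁) :=
    (integrable_const 1).sub (hexp _ ht2)
  have hR : δ + 2 * (1 - ∫ x, ∑ A : Fin m → Bool, meanNbrWeight P₂ n m x A *
      Real.exp (-(n / √((n : ℝ) * m) / K * setWeight x A)) ∂(Measure.pi fun _ : Fin m => P₁)) =
      ∫ x, (δ + 2 * (1 - ∑ A : Fin m → Bool, meanNbrWeight P₂ n m x A *
      Real.exp (-(n / √((n : ℝ) * m) / K * setWeight x A)))) ∂(Measure.pi fun _ : Fin m => P₁) := by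
    rw [integral_add (integrable_const _) (hone.const_mul 2), integral_const_mul, integral_sub (integrable_const 1) (hexp _ ht2)]
    simp
  rw [hR]
  refine integral_mono (hpow.sub (hexp _ ht1)).abs
    ((integrable_const _).add (hone.const_mul 2)) fun x => ?_
  have hsum := sum_meanNbrWeight P₂ (n := n) x
  -- The mean neighbourhood weights sum to one, so the constant can be distributed over the sets A,
  -- leaving a termwise comparison.
  have hR' : δ + 2 * (1 - ∑ A : Fin m → Bool, meanNbrWeight P₂ n m x A *
      Real.exp (-(n / √((n : ℝ) * m) / K * setWeight x A))) =
      ∑ A : Fin m → Bool, meanNbrWeight P₂ n m x A * (δ + 2 * (1 -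
      Real.exp (-(n / √((n : ℝ) * m) / K * setWeight x A)))) := by
    simp_rw [mul_add, mul_left_comm _ (2 : ℝ), mul_sub, Finset.sum_add_distrib, ← Finset.sum_mul,
      Finset.sum_sub_distrib, ← Finset.mul_sum, mul_one, hsum]
    ring
  simp only []
  rw [hR', ← Finset.sum_sub_distrib]
  refine (Finset.abs_sum_le_sum_abs _ _).trans (Finset.sum_le_sum fun A _ => ?_)
  rw [← mul_sub, abs_mul, abs_of_nonneg (meanNbrWeight_nonneg P₂ x A)]
  exact mul_le_mul_of_nonneg_left (abs_binomial_sub_poisson_le P₂ hP hn hz (by linarith) hK x A)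
    (meanNbrWeight_nonneg P₂ x A)

/-! ### Limits of the Laplace transforms and of the generating functions -/

theorem tendsto_one_sub_pow_exp {m : ℕ → ℕ} (hm : Tendsto m atTop atTop) {u : ℕ → ℝ} {l : ℝ}
    (h0 : ∀ k, 0 ≤ u k) (h1 : ∀ k, u k ≤ 1) (hu : Tendsto (fun k => m k * u k) atTop (𝓝 l)) :
    Tendsto (fun k => (1 - u k) ^ m k) atTop (𝓝 (Real.exp (-l))) := by
  have hm' : Tendsto (fun k => (m k : ℝ)) atTop atTop := tendsto_natCast_atTop_atTop.comp hm
  have hsq : Tendsto (fun k => (m k * u k) ^ 2 / m k) atTop (𝓝 0) := (hu.pow 2).div_atTop hm'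
  have hdiff : Tendsto (fun k => (1 - u k) ^ m k - Real.exp (-(m k * u k))) atTop (𝓝 0) := by
    refine squeeze_zero_norm' ?_ hsq
    filter_upwards [hm.eventually_gt_atTop 0] with k hk
    have hk' : (0 : ℝ) < m k := by exact_mod_cast hk
    refine (abs_one_sub_pow_sub_exp_le (m k) (h0 k) (h1 k)).trans_eq ?_
    field_simp
  have := hdiff.add (hu.neg.rexp)
  simpa using this

theorem measurable_laplaceDefect (P : Measure ℝ≥0) [IsProbabilityMeasure P] (n m : ℕ) (t : ℝ) :
    Measurable (laplaceDefect P n m t) := by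
  have h : Measurable fun a : ℝ≥0 × ℝ≥0 =>
      (edgeProb n m a.2 a.1 : ℝ) * (1 - Real.exp (-(t * a.2))) := by fun_prop
  exact h.stronglyMeasurable.integral_prod_right'.measurable

theorem one_sub_laplaceDefect_pow_mem (P : Measure ℝ≥0) [IsProbabilityMeasure P] {n m : ℕ} {t : ℝ}
    (ht : 0 ≤ t) (y : ℝ≥0) :
    0 ≤ (1 - laplaceDefect P n m t y) ^ m ∧ (1 - laplaceDefect P n m t y) ^ m ≤ 1 :=
  ⟨pow_nonneg (sub_nonneg.2 (laplaceDefect_le_one P ht y)) _,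
    pow_le_one₀ (sub_nonneg.2 (laplaceDefect_le_one P ht y))
      (by linarith [laplaceDefect_nonneg P (n := n) (m := m) ht y])⟩

theorem tendsto_nbrLaplace (P₁ P₂ : Measure ℝ≥0) [IsProbabilityMeasure P₁]
    [IsProbabilityMeasure P₂] {n m : ℕ → ℕ} (hm : Tendsto m atTop atTop) {t : ℕ → ℝ}
    (ht : ∀ k, 0 ≤ t k) {l : ℝ≥0 → ℝ}
    (hl : ∀ y, Tendsto (fun k => m k * laplaceDefect P₁ (n k) (m k) (t k) y) atTop (𝓝 (l y))) :
    Tendsto (fun k => nbrLaplace P₁ P₂ (n k) (m k) (t k)) atTop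
      (𝓝 (∫ y, Real.exp (-l y) ∂P₂)) := by
  refine tendsto_integral_of_dominated_convergence (fun _ => 1)
    (fun k => ((measurable_const.sub (measurable_laplaceDefect P₁ _ _ _)).pow_const
      _).aestronglyMeasurable) (integrable_const 1) (fun k => .of_forall fun y => ?_)
    (.of_forall fun y => ?_)
  · have h := one_sub_laplaceDefect_pow_mem P₁ (n := n k) (m := m k) (ht k) y
    rw [Real.norm_eq_abs, abs_of_nonneg h.1]
    exact h.2
  · exact tendsto_one_sub_pow_exp hm (fun k => laplaceDefect_nonneg P₁ (ht k) y)
      (fun k => laplaceDefect_le_one P₁ (ht k) y) (hl y)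

/-- One factor x comes from the edge probability and one from 1 - e^{-tx} ≤ tx; this is the source
of the second moment of P₁. -/
theorem edgeProb_mul_le {n m : ℕ} {t : ℝ} (ht : 0 ≤ t) (x y : ℝ≥0) :
    m * ((edgeProb n m x y : ℝ) * (1 - Real.exp (-(t * x)))) ≤
      m / √((n : ℝ) * m) * t * y * (x : ℝ) ^ 2 := by
  have h1 := edgeProb_le n m x y
  have h2 : 1 - Real.exp (-(t * x)) ≤ t * x := by linarith [Real.one_sub_le_exp_neg (t * x)]
  calc m * ((edgeProb n m x y : ℝ) * (1 - Real.exp (-(t * x))))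
      ≤ m * ((x : ℝ) * y / √((n : ℝ) * m) * (t * x)) := by
        gcongr
        exact one_sub_exp_nonneg (by positivity)
    _ = _ := by ring

theorem mul_laplaceDefect_le (P : Measure ℝ≥0) [IsProbabilityMeasure P]
    (hP : Integrable (fun x : ℝ≥0 => (x : ℝ) ^ 2) P) {n m : ℕ} {t : ℝ} (ht : 0 ≤ t) (y : ℝ≥0) :
    m * laplaceDefect P n m t y ≤ m / √((n : ℝ) * m) * t * rawMoment P 2 * y := by
  rw [laplaceDefect, ← integral_const_mul]
  refine (integral_mono ((integrable_edgeProb_mul P ht y).const_mul _) (hP.const_mul _)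
    (fun x => edgeProb_mul_le ht x y)).trans_eq ?_
  rw [integral_const_mul, rawMoment]
  ring

theorem div_sqrt_mul_div_sqrt {n m : ℕ} (hn : 0 < n) (hm : 0 < m) :
    (m : ℝ) / √((n : ℝ) * m) * (n / √((n : ℝ) * m)) = 1 := by
  have hn' : (0 : ℝ) < n := by exact_mod_cast hn
  have hm' : (0 : ℝ) < m := by exact_mod_cast hm
  rw [div_mul_div_comm, Real.mul_self_sqrt (by positivity)]
  field_simp

/-- Bernoulli's inequality bounds 1 - (1 - D)^m by mD. The scalings m/√(nm) and n/√(nm) have product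
1, so the resulting tail bound is uniform in n and m. -/
theorem one_sub_nbrLaplace_le (P₁ P₂ : Measure ℝ≥0) [IsProbabilityMeasure P₁]
    [IsProbabilityMeasure P₂] (hP₁ : Integrable (fun x : ℝ≥0 => (x : ℝ) ^ 2) P₁)
    (hP₂ : Integrable (fun y : ℝ≥0 => (y : ℝ)) P₂) {n m : ℕ} (hn : 0 < n) (hm : 0 < m) {K : ℝ}
    (hK : 0 < K) :
    1 - nbrLaplace P₁ P₂ n m (n / √((n : ℝ) * m) / K) ≤ rawMoment P₁ 2 * rawMoment P₂ 1 / K := by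
  set t := (n : ℝ) / √((n : ℝ) * m) / K with ht
  have ht0 : 0 ≤ t := by positivity
  have hi : Integrable (fun y => (1 - laplaceDefect P₁ n m t y) ^ m) P₂ :=
    .of_bound ((measurable_const.sub (measurable_laplaceDefect P₁ _ _ _)).pow_const
      _).aestronglyMeasurable 1 (.of_forall fun y => by
        have h := one_sub_laplaceDefect_pow_mem P₁ (n := n) (m := m) ht0 y
        rw [Real.norm_eq_abs, abs_of_nonneg h.1]
        exact h.2)
  have he : 1 - nbrLaplace P₁ P₂ n m t = ∫ y, (1 - (1 - laplaceDefect P₁ n m t y) ^ m) ∂P₂ := by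
    rw [integral_sub (integrable_const 1) hi]
    simp [nbrLaplace]
  have hr : rawMoment P₁ 2 * rawMoment P₂ 1 / K = ∫ y : ℝ≥0, rawMoment P₁ 2 / K * (y : ℝ) ∂P₂ := by
    rw [integral_const_mul, rawMoment, rawMoment]
    simp only [pow_one]
    ring
  rw [he, hr]
  refine integral_mono ((integrable_const 1).sub hi) (hP₂.const_mul _) fun y => ?_
  have h1 := one_add_mul_le_pow (a := -laplaceDefect P₁ n m t y)
    (by linarith [laplaceDefect_le_one P₁ (n := n) (m := m) ht0 y]) m
  have h2 := mul_laplaceDefect_le P₁ hP₁ (n := n) (m := m) ht0 y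
  have h3 : (m : ℝ) / √((n : ℝ) * m) * t * rawMoment P₁ 2 * y = rawMoment P₁ 2 / K * y := by
    have := div_sqrt_mul_div_sqrt hn hm
    calc (m : ℝ) / √((n : ℝ) * m) * t * rawMoment P₁ 2 * y
        = ((m : ℝ) / √((n : ℝ) * m) * (n / √((n : ℝ) * m))) * (rawMoment P₁ 2 / K * y) := by
          rw [ht]; ring
      _ = _ := by rw [this, one_mul]
  rw [← sub_eq_add_neg] at h1
  simp only []
  linarith

theorem tendsto_integral_pow_deg (P₁ P₂ : Measure ℝ≥0) [IsProbabilityMeasure P₁]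
    [IsProbabilityMeasure P₂] (hP₁ : Integrable (fun x : ℝ≥0 => (x : ℝ) ^ 2) P₁)
    (hP₂ : Integrable (fun y : ℝ≥0 => (y : ℝ)) P₂) {n m : ℕ → ℕ}
    (hn : Tendsto n atTop atTop) (hm : Tendsto m atTop atTop) (v : ∀ k, Fin (n k))
    {z l : ℝ} (h0 : 0 ≤ z) (h1 : z ≤ 1)
    (hl : Tendsto (fun k => nbrLaplace P₁ P₂ (n k) (m k)
      ((1 - z) * rawMoment P₂ 1 * (n k / √((n k : ℝ) * m k)))) atTop (𝓝 l)) :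
    Tendsto (fun k => ∫ ω, z ^ deg (v k) ω ∂(modelMeasure P₁ P₂ (n k) (m k))) atTop (𝓝 l) := by
  suffices h : Tendsto (fun k => ∫ ω, z ^ deg (v k) ω ∂(modelMeasure P₁ P₂ (n k) (m k)) -
      nbrLaplace P₁ P₂ (n k) (m k) ((1 - z) * rawMoment P₂ 1 * (n k / √((n k : ℝ) * m k))))
      atTop (𝓝 0) by
    simpa using h.add hl
  have hn' : Tendsto (fun k => (n k : ℝ)) atTop atTop := tendsto_natCast_atTop_atTop.comp hn
  rw [Metric.tendsto_nhds]
  intro ε hε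
  have hc : 0 ≤ rawMoment P₁ 2 * rawMoment P₂ 1 :=
    mul_nonneg (integral_nonneg fun y => by positivity) (integral_nonneg fun y => by positivity)
  set c := rawMoment P₁ 2 * rawMoment P₂ 1
  -- This makes the tail error 2c/K smaller than ε/2; the added 1 keeps K positive when c = 0. K is
  -- fixed before k grows.
  set K := 4 * (c + 1) / ε with hKdef
  have hK : 0 < K := by positivity
  have hδ : Tendsto (fun k => rawMoment P₂ 1 * K / n k + (rawMoment P₂ 1 * K) ^ 2 / n k +
      ∫ y, expDefect (n k) (y * K) ∂P₂) atTop (𝓝 0) := by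
    simpa using ((hn'.const_div_atTop _).add (hn'.const_div_atTop _)).add
      (tendsto_integral_expDefect P₂ hP₂ hn hK.le)
  filter_upwards [hm.eventually_gt_atTop 0, hδ.eventually_lt_const (half_pos hε)] with k hk hk'
  have hmain := abs_integral_pow_deg_sub_nbrLaplace_le P₁ P₂ hP₂ (m := m k) (v k) h0 h1 hK
  have htail := one_sub_nbrLaplace_le P₁ P₂ hP₁ hP₂ (v k).pos hk hK
  have hcK : c / K < ε / 4 := by
    rw [div_lt_div_iff₀ hK (by norm_num), hKdef]
    field_simp
    linarith
  rw [Real.dist_eq, sub_zero]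
  linarith

/-- Dominated convergence in x, with dominating function c y x². For fixed x and y the truncation in
the edge probability eventually disappears because √(nm) → ∞; `G` isolates the part that depends on
the regime of m/n. -/
theorem tendsto_mul_laplaceDefect (P : Measure ℝ≥0) [IsProbabilityMeasure P]
    (hP : Integrable (fun x : ℝ≥0 => (x : ℝ) ^ 2) P) {n m : ℕ → ℕ} (hpos : ∀ k, 0 < n k)
    (hn : Tendsto n atTop atTop) (hm : Tendsto m atTop atTop) {c : ℝ} (hc : 0 ≤ c) {G : ℝ≥0 → ℝ}
    (hG : ∀ x : ℝ≥0, Tendsto (fun k => (m k : ℝ) / √((n k : ℝ) * m k) *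
      (1 - Real.exp (-(c * (n k / √((n k : ℝ) * m k)) * x)))) atTop (𝓝 (G x))) (y : ℝ≥0) :
    Tendsto (fun k => m k * laplaceDefect P (n k) (m k) (c * (n k / √((n k : ℝ) * m k))) y) atTop
      (𝓝 (∫ x : ℝ≥0, (x : ℝ) * y * G x ∂P)) := by
  simp_rw [laplaceDefect, ← integral_const_mul]
  have hn' : Tendsto (fun k => (n k : ℝ)) atTop atTop := tendsto_natCast_atTop_atTop.comp hn
  have hm' : Tendsto (fun k => (m k : ℝ)) atTop atTop := tendsto_natCast_atTop_atTop.comp hm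
  have hsqrt : Tendsto (fun k => √((n k : ℝ) * m k)) atTop atTop :=
    Real.tendsto_sqrt_atTop.comp (hn'.atTop_mul_atTop₀ hm')
  have ht : ∀ k, 0 ≤ c * (n k / √((n k : ℝ) * m k)) := fun k => by positivity
  refine tendsto_integral_filter_of_dominated_convergence (fun x : ℝ≥0 => c * y * (x : ℝ) ^ 2)
    (.of_forall fun k => by fun_prop) ?_ (hP.const_mul _) (.of_forall fun x => ?_)
  · filter_upwards [hm.eventually_gt_atTop 0] with k hk
    refine .of_forall fun x => ?_
    rw [Real.norm_eq_abs, abs_of_nonneg (mul_nonneg (by positivity) (edgeProb_mul_nonneg (ht k) x y))]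
    refine (edgeProb_mul_le (ht k) x y).trans_eq ?_
    have := div_sqrt_mul_div_sqrt (hpos k) hk
    calc (m k : ℝ) / √((n k : ℝ) * m k) * (c * (n k / √((n k : ℝ) * m k))) * y * (x : ℝ) ^ 2
        = ((m k : ℝ) / √((n k : ℝ) * m k) * (n k / √((n k : ℝ) * m k))) *
            (c * y * (x : ℝ) ^ 2) := by ring
      _ = _ := by rw [this, one_mul]
  · refine ((hG x).const_mul ((x : ℝ) * y)).congr' ?_
    filter_upwards [hsqrt.eventually_ge_atTop ((x : ℝ) * y), hsqrt.eventually_gt_atTop 0]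
      with k hk hk0
    have he : (edgeProb (n k) (m k) x y : ℝ) = x * y / √((n k : ℝ) * m k) :=
      min_eq_right ((div_le_one hk0).2 hk)
    rw [he]
    ring

theorem div_sqrt_mul_eq (n m : ℕ) (hn : 0 < n) :
    (m : ℝ) / √((n : ℝ) * m) = √((m : ℝ) / n) := by
  have hn' : (0 : ℝ) < n := by exact_mod_cast hn
  rw [Real.sqrt_mul hn'.le, Real.sqrt_div' _ hn'.le, mul_comm, ← div_div, Real.div_sqrt]

theorem div_sqrt_mul_eq_inv (n m : ℕ) :
    (n : ℝ) / √((n : ℝ) * m) = (√((m : ℝ) / n))⁻¹ := by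
  have hn' : (0 : ℝ) ≤ n := by positivity
  rw [Real.sqrt_mul hn', Real.sqrt_div' _ hn', ← div_div, Real.div_sqrt, inv_div]

theorem tendsto_integral_pow_deg_of_ratio (P₁ P₂ : Measure ℝ≥0) [IsProbabilityMeasure P₁]
    [IsProbabilityMeasure P₂] (hP₁ : Integrable (fun x : ℝ≥0 => (x : ℝ) ^ 2) P₁)
    (hP₂ : Integrable (fun y : ℝ≥0 => (y : ℝ)) P₂) {n m : ℕ → ℕ}
    (hn : Tendsto n atTop atTop) (hm : Tendsto m atTop atTop) (v : ∀ k, Fin (n k)) {β : ℝ}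
    (hβ : 0 < β) (hr : Tendsto (fun k => (m k : ℝ) / n k) atTop (𝓝 β))
    {z : ℝ} (h0 : 0 ≤ z) (h1 : z ≤ 1) :
    Tendsto (fun k => ∫ ω, z ^ deg (v k) ω ∂(modelMeasure P₁ P₂ (n k) (m k))) atTop
      (𝓝 (∫ y : ℝ≥0, Real.exp (-∫ x : ℝ≥0, (x : ℝ) * y * (√β *
        (1 - Real.exp (-((1 - z) * rawMoment P₂ 1 * (√β)⁻¹ * x)))) ∂P₁) ∂P₂)) := by
  have hb : 0 ≤ rawMoment P₂ 1 := integral_nonneg fun y => by positivity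
  have hc : 0 ≤ (1 - z) * rawMoment P₂ 1 := mul_nonneg (by linarith) hb
  have hs : Tendsto (fun k => √((m k : ℝ) / n k)) atTop (𝓝 (√β)) := hr.sqrt
  refine tendsto_integral_pow_deg P₁ P₂ hP₁ hP₂ hn hm v h0 h1
    (tendsto_nbrLaplace P₁ P₂ hm (fun k => by positivity)
      (tendsto_mul_laplaceDefect P₁ hP₁ (fun k => (v k).pos) hn hm hc fun x => ?_))
  simp_rw [div_sqrt_mul_eq _ _ (v _).pos, div_sqrt_mul_eq_inv]
  exact hs.mul ((((hs.inv₀ (Real.sqrt_pos.2 hβ).ne').const_mul _).mul_const _).neg.rexp.const_sub _)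

/-- The limit is the right derivative at 0 of u ↦ 1 - e^{-au}, taken along u = r⁻¹. -/
theorem tendsto_inv_mul_one_sub_exp (a : ℝ) :
    Tendsto (fun r : ℝ => r * (1 - Real.exp (-(a * r⁻¹)))) atTop (𝓝 a) := by
  have hd : HasDerivAt (fun u : ℝ => 1 - Real.exp (-(a * u))) a 0 := by
    have h := (((hasDerivAt_id (0 : ℝ)).const_mul a).neg.exp).const_sub 1
    simpa using h
  have hs := hd.tendsto_slope_zero_right.comp tendsto_inv_atTop_nhdsGT_zero
  refine hs.congr fun r => ?_
  simp

theorem tendsto_integral_pow_deg_of_ratio_atTop (P₁ P₂ : Measure ℝ≥0) [IsProbabilityMeasure P₁]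
    [IsProbabilityMeasure P₂] (hP₁ : Integrable (fun x : ℝ≥0 => (x : ℝ) ^ 2) P₁)
    (hP₂ : Integrable (fun y : ℝ≥0 => (y : ℝ)) P₂) {n m : ℕ → ℕ}
    (hn : Tendsto n atTop atTop) (hm : Tendsto m atTop atTop) (v : ∀ k, Fin (n k))
    (hr : Tendsto (fun k => (m k : ℝ) / n k) atTop atTop) {z : ℝ} (h0 : 0 ≤ z) (h1 : z ≤ 1) :
    Tendsto (fun k => ∫ ω, z ^ deg (v k) ω ∂(modelMeasure P₁ P₂ (n k) (m k))) atTop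
      (𝓝 (∫ y : ℝ≥0, Real.exp (-((1 - z) * (y * rawMoment P₁ 2 * rawMoment P₂ 1))) ∂P₂)) := by
  have hb : 0 ≤ rawMoment P₂ 1 := integral_nonneg fun y => by positivity
  have hc : 0 ≤ (1 - z) * rawMoment P₂ 1 := mul_nonneg (by linarith) hb
  have hs : Tendsto (fun k => √((m k : ℝ) / n k)) atTop atTop := Real.tendsto_sqrt_atTop.comp hr
  have e : ∀ y : ℝ≥0, (1 - z) * (y * rawMoment P₁ 2 * rawMoment P₂ 1) =
      ∫ x : ℝ≥0, (x : ℝ) * y * ((1 - z) * rawMoment P₂ 1 * x) ∂P₁ := by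
    intro y
    have : ∀ x : ℝ≥0, (x : ℝ) * y * ((1 - z) * rawMoment P₂ 1 * x) =
      ((1 - z) * y * rawMoment P₂ 1) * (x : ℝ) ^ 2 := fun x => by ring
    simp_rw [this]
    rw [integral_const_mul, ← rawMoment]
    ring
  simp_rw [e]
  refine tendsto_integral_pow_deg P₁ P₂ hP₁ hP₂ hn hm v h0 h1
    (tendsto_nbrLaplace P₁ P₂ hm (fun k => by positivity)
      (tendsto_mul_laplaceDefect P₁ hP₁ (fun k => (v k).pos) hn hm hc fun x => ?_))
  simp_rw [div_sqrt_mul_eq _ _ (v _).pos, div_sqrt_mul_eq_inv, mul_right_comm _ _ (x : ℝ)]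
  exact (tendsto_inv_mul_one_sub_exp _).comp hs

/-! ### From generating functions to convergence in distribution -/

theorem exists_continuous_indicator_two_inv_pow (r : ℕ) :
    ∃ f : ℝ → ℝ, Continuous f ∧ ∀ j : ℕ, f ((1 / 2) ^ j) = if j = r then 1 else 0 := by
  -- A tent centred at 2^{-r} of half-width 2^{-(r+1)}, exactly the distance to the nearest other
  -- power 2^{-(r+1)}.
  refine ⟨fun u => max 0 (1 - 2 ^ (r + 1) * |u - (1 / 2) ^ r|), by fun_prop, fun j => ?_⟩
  have hr : (0 : ℝ) < (1 / 2) ^ r := by positivity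
  have h2 : (2 : ℝ) ^ (r + 1) * (1 / 2) ^ r = 2 := by
    rw [pow_succ, mul_right_comm, ← mul_pow]; norm_num
  have h2' : (0 : ℝ) < 2 ^ (r + 1) := by positivity
  split_ifs with h
  · subst h; simp
  · refine max_eq_left ?_
    rcases Nat.lt_or_gt_of_ne h with hj | hj
    · have h3 : (1 / 2 : ℝ) ^ r ≤ (1 / 2) ^ (j + 1) :=
        pow_le_pow_of_le_one (by norm_num) (by norm_num) hj
      have h4 : (1 / 2 : ℝ) ^ r ≤ (1 / 2) ^ j - (1 / 2) ^ r := by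
        rw [pow_succ] at h3; linarith
      have h5 := h4.trans (le_abs_self _)
      nlinarith
    · have h3 : (1 / 2 : ℝ) ^ j ≤ (1 / 2) ^ (r + 1) :=
        pow_le_pow_of_le_one (by norm_num) (by norm_num) hj
      have h4 : (1 / 2 : ℝ) ^ r / 2 ≤ (1 / 2) ^ r - (1 / 2) ^ j := by
        rw [pow_succ] at h3; linarith
      have h5 := h4.trans ((le_abs_self _).trans_eq (abs_sub_comm _ _))
      nlinarith

theorem prob_eq_integral_ite {Ω : Type*} [MeasurableSpace Ω] (μ : Measure Ω) {X : Ω → ℕ}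
    (hX : Measurable X) (r : ℕ) :
    μ.real {ω | X ω = r} = ∫ ω, (if X ω = r then (1 : ℝ) else 0) ∂μ := by
  have hms : MeasurableSet {ω | X ω = r} := hX (measurableSet_singleton r)
  rw [← integral_indicator_one hms]
  simp [Set.indicator_apply]

theorem abs_integral_eval_sub_prob_le {Ω : Type*} [MeasurableSpace Ω] (μ : Measure Ω)
    [IsProbabilityMeasure μ] {X : Ω → ℕ} (hX : Measurable X) {r : ℕ} {p : Polynomial ℝ} {ε : ℝ}
    (hp : ∀ j : ℕ, |p.eval ((1 / 2) ^ j) - if j = r then 1 else 0| ≤ ε) :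
    |∫ ω, p.eval ((1 / 2) ^ X ω) ∂μ - μ.real {ω | X ω = r}| ≤ ε := by
  have hi1 : Integrable (fun ω => if X ω = r then (1 : ℝ) else 0) μ :=
    .of_bound ((measurable_of_countable fun j : ℕ => if j = r then (1 : ℝ) else 0).comp
      hX).aestronglyMeasurable 1 (.of_forall fun ω => by split_ifs <;> simp)
  have hi2 : Integrable (fun ω => p.eval ((1 / 2) ^ X ω) - if X ω = r then (1 : ℝ) else 0) μ :=
    .of_bound ((measurable_of_countable fun j : ℕ => p.eval ((1 / 2) ^ j) -
      if j = r then (1 : ℝ) else 0).comp hX).aestronglyMeasurable ε (.of_forall fun ω => hp _)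
  have hi3 : Integrable (fun ω => p.eval ((1 / 2) ^ X ω)) μ := by
    refine (hi2.add hi1).congr (.of_forall fun ω => ?_)
    simp
  rw [prob_eq_integral_ite μ hX, ← integral_sub hi3 hi1]
  have h := norm_integral_le_of_norm_le_const (μ := μ) (C := ε)
    (f := fun ω => p.eval ((1 / 2) ^ X ω) - if X ω = r then (1 : ℝ) else 0)
    (.of_forall fun ω => hp (X ω))
  simpa using h

/-- Polynomials in 2^{-X} have expectations that are linear combinations of the generating function
at the points 2^{-i}, so Weierstrass approximation of the tent recovers point probabilities. -/
theorem integral_eval_pow {Ω : Type*} [MeasurableSpace Ω] (μ : Measure Ω) [IsProbabilityMeasure μ]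
    {X : Ω → ℕ} (hX : Measurable X) (p : Polynomial ℝ) :
    ∫ ω, p.eval ((1 / 2) ^ X ω) ∂μ =
      ∑ i ∈ Finset.range (p.natDegree + 1), p.coeff i * ∫ ω, ((1 / 2 : ℝ) ^ i) ^ X ω ∂μ := by
  simp_rw [Polynomial.eval_eq_sum_range, ← integral_const_mul]
  rw [← integral_finsetSum]
  · refine integral_congr_ae (.of_forall fun ω => Finset.sum_congr rfl fun i _ => ?_)
    rw [← pow_mul, ← pow_mul, mul_comm i]
  · intro i _
    refine Integrable.const_mul (.of_bound ((measurable_of_countable fun j : ℕ =>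
      ((1 / 2 : ℝ) ^ i) ^ j).comp hX).aestronglyMeasurable 1 (.of_forall fun ω => ?_)) _
    rw [Real.norm_eq_abs, abs_of_nonneg (pow_nonneg (pow_nonneg (by norm_num) _) _)]
    exact pow_le_one₀ (by positivity) (pow_le_one₀ (by norm_num) (by norm_num))

/-- Convergence of the probability generating functions on `[0, 1]` implies convergence of the
point probabilities. -/
theorem tendsto_prob_of_tendsto_pgf {Ω : ℕ → Type*} [∀ k, MeasurableSpace (Ω k)] {Ω' : Type*}
    [MeasurableSpace Ω'] (μ : ∀ k, Measure (Ω k)) [∀ k, IsProbabilityMeasure (μ k)]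
    (ν : Measure Ω') [IsProbabilityMeasure ν] {X : ∀ k, Ω k → ℕ} {Z : Ω' → ℕ}
    (hX : ∀ k, Measurable (X k)) (hZ : Measurable Z)
    (h : ∀ z : ℝ, 0 ≤ z → z ≤ 1 →
      Tendsto (fun k => ∫ ω, z ^ X k ω ∂(μ k)) atTop (𝓝 (∫ ω, z ^ Z ω ∂ν))) (r : ℕ) :
    Tendsto (fun k => (μ k).real {ω | X k ω = r}) atTop (𝓝 (ν.real {ω | Z ω = r})) := by
  obtain ⟨f, hf, hfr⟩ := exists_continuous_indicator_two_inv_pow r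
  rw [Metric.tendsto_nhds]
  intro ε hε
  obtain ⟨p, hp⟩ := exists_polynomial_near_of_continuousOn 0 1 f hf.continuousOn (ε / 4)
    (by positivity)
  have hp' : ∀ j : ℕ, |p.eval ((1 / 2) ^ j) - if j = r then 1 else 0| ≤ ε / 4 := by
    intro j
    rw [← hfr j]
    exact (hp _ ⟨by positivity, pow_le_one₀ (by norm_num) (by norm_num)⟩).le
  have hlim : Tendsto (fun k => ∫ ω, p.eval ((1 / 2) ^ X k ω) ∂(μ k)) atTop
      (𝓝 (∫ ω, p.eval ((1 / 2) ^ Z ω) ∂ν)) := by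
    simp_rw [integral_eval_pow _ hZ, fun k => integral_eval_pow (μ k) (hX k)]
    exact tendsto_finsetSum _ fun i _ => (h _ (by positivity)
      (pow_le_one₀ (by norm_num) (by norm_num))).const_mul _
  filter_upwards [(Metric.tendsto_nhds.1 hlim) (ε / 4) (by positivity)] with k hk
  rw [Real.dist_eq] at hk ⊢
  have h1 := abs_le.1 (abs_integral_eval_sub_prob_le (μ k) (hX k) hp')
  have h2 := abs_le.1 (abs_integral_eval_sub_prob_le ν hZ hp')
  have h3 := abs_lt.1 hk
  rw [abs_lt]
  constructor <;> linarith [h1.1, h1.2, h2.1, h2.2, h3.1, h3.2]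

/-- Portmanteau on ℕ: the limit mass of an open set is a supremum over its finite subsets, on which
the masses converge. -/
theorem tendstoInDistribution_of_tendsto_pgf {Ω : ℕ → Type*} [∀ k, MeasurableSpace (Ω k)]
    {Ω' : Type*} [MeasurableSpace Ω'] (μ : ∀ k, Measure (Ω k)) [∀ k, IsProbabilityMeasure (μ k)]
    (ν : Measure Ω') [IsProbabilityMeasure ν] {X : ∀ k, Ω k → ℕ} {Z : Ω' → ℕ}
    (hX : ∀ k, Measurable (X k)) (hZ : Measurable Z)
    (h : ∀ z : ℝ, 0 ≤ z → z ≤ 1 →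
      Tendsto (fun k => ∫ ω, z ^ X k ω ∂(μ k)) atTop (𝓝 (∫ ω, z ^ Z ω ∂ν))) :
    TendstoInDistribution X atTop Z μ ν := by
  refine ⟨fun k => (hX k).aemeasurable, hZ.aemeasurable, ?_⟩
  refine tendsto_of_forall_isOpen_le_liminf' fun G _ => ?_
  have hpt : ∀ r : ℕ, Tendsto (fun k => (μ k).map (X k) {r}) atTop (𝓝 (ν.map Z {r})) := by
    intro r
    have := ENNReal.tendsto_ofReal (tendsto_prob_of_tendsto_pgf μ ν hX hZ h r)
    rw [ofReal_measureReal] at this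
    simp_rw [fun k => ofReal_measureReal (μ := μ k) (s := {ω | X k ω = r})] at this
    rw [Measure.map_apply hZ (measurableSet_singleton r)]
    simp_rw [fun k => Measure.map_apply (μ := μ k) (hX k) (measurableSet_singleton r)]
    exact this
  change ν.map Z G ≤ liminf (fun k => (μ k).map (X k) G) atTop
  have hG : ν.map Z G = ∑' r : G, ν.map Z {(r : ℕ)} := by
    rw [← Measure.tsum_indicator_apply_singleton _ _ (Set.to_countable G).measurableSet,
      tsum_subtype G fun r => ν.map Z {r}]
  rw [hG, ENNReal.tsum_eq_iSup_sum]
  refine iSup_le fun s => ?_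
  rw [← (tendsto_finsetSum s fun r _ => hpt r).liminf_eq]
  refine liminf_le_liminf (.of_forall fun k => ?_)
  have hs := sum_measure_singleton (s := s.map (Function.Embedding.subtype _))
    (μ := (μ k).map (X k))
  rw [Finset.sum_map] at hs
  refine (le_of_eq hs).trans (measure_mono ?_)
  intro r hr
  obtain ⟨a, _, rfl⟩ := Finset.mem_map.1 (Finset.mem_coe.1 hr)
  exact a.2

/-! ### Generating functions of mixed Poisson laws, size-biased shifts and random sums -/

theorem integral_comp_eq_of_hasSum {Ω : Type*} [MeasurableSpace Ω] (μ : Measure Ω)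
    [IsProbabilityMeasure μ] {X : Ω → ℕ} (hX : Measurable X) {f : ℕ → ℝ} (hf : ∀ r, 0 ≤ f r)
    {c : ℝ} (h : HasSum (fun r => μ.real {ω | X ω = r} * f r) c) : ∫ ω, f (X ω) ∂μ = c := by
  have := Measure.isProbabilityMeasure_map (μ := μ) hX.aemeasurable
  have hr : ∀ r, ((μ.map X) {r}).toReal = μ.real {ω | X ω = r} := fun r => by
    rw [Measure.map_apply hX (measurableSet_singleton r)]; rfl
  rw [← integral_map hX.aemeasurable (measurable_of_countable f).aestronglyMeasurable,
    ← Measure.sum_smul_dirac (μ.map X), integral_sum_dirac_eq_tsum]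
  · simp_rw [hr, smul_eq_mul]
    exact h.tsum_eq
  · exact fun r => measure_ne_top _ _
  · simp_rw [hr, Real.norm_eq_abs, fun r => abs_of_nonneg (hf r)]
    exact h.summable

theorem hasSum_integral_of_nonneg {α : Type*} [MeasurableSpace α] {μ : Measure α}
    {F : ℕ → α → ℝ} {g : α → ℝ} (hF : ∀ r, Measurable (F r)) (h0 : ∀ r a, 0 ≤ F r a)
    (hg : ∀ a, HasSum (fun r => F r a) (g a)) (hi : Integrable g μ) :
    HasSum (fun r => ∫ a, F r a ∂μ) (∫ a, g a ∂μ) := by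
  have hFi : ∀ r, Integrable (F r) μ := fun r =>
    hi.mono' (hF r).aestronglyMeasurable (.of_forall fun a => by
      rw [Real.norm_eq_abs, abs_of_nonneg (h0 r a)]
      exact le_hasSum (hg a) r fun i _ => h0 i a)
  have h := hasSum_integral_of_summable_integral_norm hFi ?_
  · simpa [fun a => (hg a).tsum_eq] using h
  · simp_rw [Real.norm_eq_abs, fun r a => abs_of_nonneg (h0 r a)]
    refine summable_of_sum_range_le (c := ∫ a, g a ∂μ)
      (fun r => integral_nonneg (h0 r)) fun N => ?_
    rw [← integral_finsetSum _ fun r _ => hFi r]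
    exact integral_mono (integrable_finsetSum _ fun r _ => hFi r) hi fun a =>
      sum_le_hasSum _ (fun i _ => h0 i a) (hg a)

theorem hasSum_pow_div_factorial (x : ℝ) : HasSum (fun r : ℕ => x ^ r / r !) (Real.exp x) := by
  rw [Real.exp_eq_exp_ℝ]
  exact NormedSpace.expSeries_div_hasSum_exp x

theorem IsMixedPoisson.hasSum_prob_mul_pow {Ω : Type*} [MeasurableSpace Ω] {μ : Measure Ω}
    {Λ : Ω → ℕ} {P : Measure ℝ≥0} [IsProbabilityMeasure P] {lam : ℝ≥0 → ℝ}
    (hΛ : IsMixedPoisson μ Λ P lam) (hm : Measurable lam) (h0 : ∀ x, 0 ≤ lam x) {z : ℝ}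
    (hz0 : 0 ≤ z) (hz1 : z ≤ 1) :
    HasSum (fun r => μ.real {ω | Λ ω = r} * z ^ r) (∫ x, Real.exp (-((1 - z) * lam x)) ∂P) := by
  simp_rw [hΛ.prob_eq, ← integral_mul_const]
  refine hasSum_integral_of_nonneg (fun r => by fun_prop) (fun r x => ?_) (fun x => ?_) ?_
  · have := h0 x
    positivity
  · have h := (hasSum_pow_div_factorial (lam x * z)).mul_left (Real.exp (-lam x))
    rw [← Real.exp_add] at h
    convert! h using 1
    · ext r; rw [mul_pow]; ring
    · ring_nf
  · refine .of_bound (by fun_prop) 1 (.of_forall fun x => ?_)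
    rw [Real.norm_eq_abs, Real.abs_exp, Real.exp_le_one_iff]
    have := mul_nonneg (sub_nonneg.2 hz1) (h0 x)
    linarith

theorem IsMixedPoisson.integral_pow {Ω : Type*} [MeasurableSpace Ω] {μ : Measure Ω}
    [IsProbabilityMeasure μ] {Λ : Ω → ℕ} {P : Measure ℝ≥0} [IsProbabilityMeasure P]
    {lam : ℝ≥0 → ℝ} (hΛ : IsMixedPoisson μ Λ P lam) (hm : Measurable lam) (h0 : ∀ x, 0 ≤ lam x)
    {z : ℝ} (hz0 : 0 ≤ z) (hz1 : z ≤ 1) :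
    ∫ ω, z ^ Λ ω ∂μ = ∫ x, Real.exp (-((1 - z) * lam x)) ∂P :=
  integral_comp_eq_of_hasSum μ hΛ.measurable (fun r => pow_nonneg hz0 r)
    (hΛ.hasSum_prob_mul_pow hm h0 hz0 hz1)

/-- This is the derivative of the mixed Poisson generating function, obtained termwise from (r +
1)/(r + 1)! = 1/r!. At z = 1 it gives the mean, and divided by the mean it gives the generating
function of the size-biased shift. -/
theorem IsMixedPoisson.hasSum_succ_mul_prob_mul_pow {Ω : Type*} [MeasurableSpace Ω]
    {μ : Measure Ω} {Λ : Ω → ℕ} {P : Measure ℝ≥0} {lam : ℝ≥0 → ℝ}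
    (hΛ : IsMixedPoisson μ Λ P lam) (hm : Measurable lam) (h0 : ∀ x, 0 ≤ lam x)
    (hi : Integrable lam P) {z : ℝ} (hz0 : 0 ≤ z) (hz1 : z ≤ 1) :
    HasSum (fun r : ℕ => (r + 1) * μ.real {ω | Λ ω = r + 1} * z ^ r)
      (∫ x, lam x * Real.exp (-((1 - z) * lam x)) ∂P) := by
  simp_rw [hΛ.prob_eq, ← integral_const_mul, ← integral_mul_const]
  refine hasSum_integral_of_nonneg (fun r => by fun_prop) (fun r x => ?_) (fun x => ?_) ?_
  · have := h0 x
    positivity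
  · have h := (hasSum_pow_div_factorial (lam x * z)).mul_left (lam x * Real.exp (-lam x))
    rw [mul_assoc, ← Real.exp_add] at h
    convert! h using 1
    · ext r
      rw [mul_pow, Nat.factorial_succ]
      push_cast
      field_simp
      ring
    · ring_nf
  · refine hi.mono' (by fun_prop) (.of_forall fun x => ?_)
    have := mul_nonneg (sub_nonneg.2 hz1) (h0 x)
    rw [Real.norm_eq_abs, abs_mul, Real.abs_exp, abs_of_nonneg (h0 x)]
    exact mul_le_of_le_one_right (h0 x) (Real.exp_le_one_iff.2 (by linarith))

theorem IsMixedPoisson.integral_eq {Ω : Type*} [MeasurableSpace Ω] {μ : Measure Ω}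
    [IsProbabilityMeasure μ] {Λ : Ω → ℕ} {P : Measure ℝ≥0} {lam : ℝ≥0 → ℝ}
    (hΛ : IsMixedPoisson μ Λ P lam) (hm : Measurable lam) (h0 : ∀ x, 0 ≤ lam x)
    (hi : Integrable lam P) : ∫ ω, (Λ ω : ℝ) ∂μ = ∫ x, lam x ∂P := by
  refine integral_comp_eq_of_hasSum μ hΛ.measurable (f := fun r => (r : ℝ))
    (fun r => Nat.cast_nonneg r) ?_
  -- The term r = 0 of the mean vanishes, so the series may be shifted to match the derivative
  -- series at z = 1.
  rw [← hasSum_nat_add_iff' 1]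
  have h := hΛ.hasSum_succ_mul_prob_mul_pow hm h0 hi zero_le_one le_rfl
  simp only [sub_self, zero_mul, neg_zero, Real.exp_zero, mul_one, one_pow] at h
  convert! h using 1
  · ext r; push_cast; ring
  · simp

theorem IsSizeBiasedShift.integral_mul_integral_pow {Ω : Type*} [MeasurableSpace Ω]
    {μ : Measure Ω} [IsProbabilityMeasure μ] {Λ τ : Ω → ℕ} {P : Measure ℝ≥0} {lam : ℝ≥0 → ℝ}
    (hτ : IsSizeBiasedShift μ τ Λ) (hΛ : IsMixedPoisson μ Λ P lam) (hm : Measurable lam)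
    (h0 : ∀ x, 0 ≤ lam x) (hi : Integrable lam P) (hne : ∫ x, lam x ∂P ≠ 0) {z : ℝ}
    (hz0 : 0 ≤ z) (hz1 : z ≤ 1) :
    (∫ x, lam x ∂P) * ∫ ω, z ^ τ ω ∂μ = ∫ x, lam x * Real.exp (-((1 - z) * lam x)) ∂P := by
  have hE := hΛ.integral_eq hm h0 hi
  have hp := hτ.prob_eq (hE ▸ hne)
  rw [hE] at hp
  have h := (hΛ.hasSum_succ_mul_prob_mul_pow hm h0 hi hz0 hz1).mul_left (∫ x, lam x ∂P)⁻¹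
  rw [integral_comp_eq_of_hasSum μ hτ.measurable (f := fun r => z ^ r)
    (fun r => pow_nonneg hz0 r) (c := (∫ x, lam x ∂P)⁻¹ * _) (h.congr_fun fun r => ?_)]
  · rw [mul_inv_cancel_left₀ hne]
  · rw [hp]; ring

theorem measurable_random_sum {Ω : Type*} [MeasurableSpace Ω] {N : Ω → ℕ} {τ : ℕ → Ω → ℕ}
    (hN : Measurable N) (hτ : ∀ j, Measurable (τ j)) :
    Measurable fun ω => ∑ j ∈ Finset.range (N ω), τ j ω := by
  have h : Measurable fun a : ℕ × Ω => ∑ j ∈ Finset.range a.1, τ j a.2 :=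
    measurable_from_prod_countable_right fun r =>
      Finset.measurable_fun_sum (Finset.range r) fun j _ => hτ j
  exact h.comp (hN.prodMk measurable_id)

/-- The generating function of a random sum of independent identically distributed terms. -/
theorem hasSum_integral_pow_random_sum {Ω : Type*} [MeasurableSpace Ω] (μ : Measure Ω)
    [IsProbabilityMeasure μ] {N : Ω → ℕ} {τ : ℕ → Ω → ℕ} (hN : Measurable N)
    (hτ : ∀ j, Measurable (τ j)) (hind : iIndepFun τ μ)
    (hid : ∀ j, IdentDistrib (τ j) (τ 0) μ μ) (hNτ : IndepFun (fun ω j => τ j ω) N μ) {z : ℝ}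
    (hz0 : 0 ≤ z) (hz1 : z ≤ 1) :
    HasSum (fun r => μ.real {ω | N ω = r} * (∫ ω, z ^ τ 0 ω ∂μ) ^ r)
      (∫ ω, z ^ (∑ j ∈ Finset.range (N ω), τ j ω) ∂μ) := by
  have hsum : ∀ r, Measurable fun ω => ∑ j ∈ Finset.range r, τ j ω := fun r =>
    Finset.measurable_fun_sum _ fun j _ => hτ j
  have hpow : Measurable fun j : ℕ => z ^ j := measurable_of_countable _
  -- On {N = r} the random sum is a sum of r fixed terms, which is independent of N and has
  -- generating function equal to an r-th power.
  have hterm : ∀ r, ∫ ω, (if N ω = r then (1 : ℝ) else 0) *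
      z ^ (∑ j ∈ Finset.range r, τ j ω) ∂μ =
      μ.real {ω | N ω = r} * (∫ ω, z ^ τ 0 ω ∂μ) ^ r := by
    intro r
    have hφ : Measurable fun t : ℕ → ℕ => z ^ (∑ j ∈ Finset.range r, t j) :=
      hpow.comp (Finset.measurable_fun_sum _ fun j _ => measurable_pi_apply j)
    have hψ : Measurable fun i : ℕ => if i = r then (1 : ℝ) else 0 := measurable_of_countable _
    have h1 := (hNτ.symm.comp hψ hφ).integral_fun_mul_eq_mul_integral
      (hψ.comp hN).aestronglyMeasurable (hpow.comp (hsum r)).aestronglyMeasurable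
    have h3 : ∫ ω, z ^ (∑ j ∈ Finset.range r, τ j ω) ∂μ = (∫ ω, z ^ τ 0 ω ∂μ) ^ r := by
      have h4 := (hind.precomp (Fin.val_injective (n := r))).integral_fun_prod_comp
        (f := fun _ j => z ^ j) (fun i => (hτ i).aemeasurable) fun i => hpow.aestronglyMeasurable
      have h5 : ∀ i : Fin r, ∫ ω, z ^ τ i ω ∂μ = ∫ ω, z ^ τ 0 ω ∂μ := fun i =>
        ((hid i).comp hpow).integral_eq
      simp_rw [← Finset.prod_pow_eq_pow_sum, Finset.prod_range]
      refine h4.trans ?_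
      simp [h5]
    rw [prob_eq_integral_ite μ hN, ← h3]
    exact h1
  simp_rw [← hterm]
  refine hasSum_integral_of_nonneg (fun r => ?_) (fun r ω => ?_) (fun ω => ?_) ?_
  · exact ((measurable_of_countable fun i : ℕ => if i = r then (1 : ℝ) else 0).comp hN).mul
      (hpow.comp (hsum r))
  · positivity
  · have h := hasSum_single (f := fun r => (if N ω = r then (1 : ℝ) else 0) *
      z ^ (∑ j ∈ Finset.range r, τ j ω)) (N ω) fun r hr => by simp [Ne.symm hr]
    simpa using h
  · refine .of_bound (hpow.comp (measurable_random_sum hN hτ)).aestronglyMeasurable 1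
      (.of_forall fun ω => ?_)
    rw [Real.norm_eq_abs, abs_of_nonneg (pow_nonneg hz0 _)]
    exact pow_le_one₀ hz0 hz1

/-! ### Isolated vertices in the sparse regime -/

/-- A lower bound for the probability that a vertex is isolated: it has no neighbours in `W`. -/
theorem integral_pow_le_prob_deg_eq_zero (P₁ P₂ : Measure ℝ≥0) [IsProbabilityMeasure P₁]
    [IsProbabilityMeasure P₂] {n m : ℕ} (v : Fin n) :
    ∫ y, (1 - ∫ x, (edgeProb n m x y : ℝ) ∂P₁) ^ m ∂P₂ ≤
      (modelMeasure P₁ P₂ n m).real {ω | deg v ω = 0} := by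
  -- The convention 0^0 = 1 makes the generating function at z = 0 the probability of degree 0.
  have hz : (modelMeasure P₁ P₂ n m).real {ω | deg v ω = 0} =
      ∫ ω, (0 : ℝ) ^ deg v ω ∂(modelMeasure P₁ P₂ n m) := by
    rw [prob_eq_integral_ite _ (measurable_deg v)]
    simp [zero_pow_eq]
  rw [hz, integral_pow_deg P₁ P₂ le_rfl zero_le_one]
  have hW : ∀ y : ℝ≥0, (1 - ∫ x, (edgeProb n m x y : ℝ) ∂P₁) ^ m =
      ∫ x : Fin m → ℝ≥0, nbrWeight n m x (fun _ => false) y ∂(Measure.pi fun _ : Fin m => P₁) := by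
    intro y
    have hi : Integrable (fun x => (edgeProb n m x y : ℝ)) P₁ :=
      .of_bound (by fun_prop) 1 (.of_forall fun x => by
        rw [Real.norm_eq_abs, abs_of_nonneg (edgeProb_nonneg _ _ _ _)]
        exact edgeProb_le_one _ _ _ _)
    simp only [nbrWeight, bernoulliWeight, Bool.false_eq_true, if_false]
    rw [integral_fintype_prod_eq_prod (fun (_ : Fin m) x => 1 - (edgeProb n m x y : ℝ))]
    simp [integral_sub (integrable_const 1) hi]
  have hint : Integrable (fun a : (Fin m → ℝ≥0) × ℝ≥0 => nbrWeight n m a.1 (fun _ => false) a.2)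
      ((Measure.pi fun _ : Fin m => P₁).prod P₂) :=
    .of_bound (measurable_nbrWeight n m _).aestronglyMeasurable 1 (.of_forall fun a => by
      rw [Real.norm_eq_abs, abs_of_nonneg (nbrWeight_nonneg _ _ _ _ _)]
      exact nbrWeight_le_one _ _ _ _ _)
  simp_rw [hW]
  rw [← integral_integral_swap hint]
  have hle : ∀ x A, (1 - 0) * hitProb P₂ n m x A ≤ 1 := fun x A => by
    simpa using hitProb_le_one P₂ x A
  have h0 : ∀ x A, 0 ≤ (1 - (1 - 0) * hitProb P₂ n m x A) ^ (n - 1) := fun x A =>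
    pow_nonneg (by linarith [hle x A]) _
  refine integral_mono hint.integral_prod_left (integrable_sum_meanNbrWeight_mul P₁ P₂
    (fun x A => (1 - (1 - 0) * hitProb P₂ n m x A) ^ (n - 1)) (fun A => ?_) h0
    fun x A => pow_le_one₀ (by linarith [hle x A]) ?_) fun x => ?_
  · have := measurable_hitProb P₂ n m A
    fun_prop
  · linarith [hitProb_nonneg P₂ x A (n := n)]
  -- Only the term of the empty neighbourhood is kept; the empty set is never hit, so its power
  -- equals 1.
  · have hempty : hitProb P₂ n m x (fun _ => false) = 0 := by simp [hitProb, missProb]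
    have h := Finset.single_le_sum (f := fun A => meanNbrWeight P₂ n m x A *
      (1 - (1 - 0) * hitProb P₂ n m x A) ^ (n - 1))
      (fun A _ => mul_nonneg (meanNbrWeight_nonneg P₂ x A) (h0 x A))
      (Finset.mem_univ fun _ => false)
    simpa [hempty, meanNbrWeight] using h

/-- The mean number of neighbours in W of a vertex of weight y is at most √(m/n) a₁ y, which tends
to 0 for each y. The integrand over y is bounded by 1, so Y needs no moment. -/
theorem tendsto_prob_deg_eq_zero (P₁ P₂ : Measure ℝ≥0) [IsProbabilityMeasure P₁]
    [IsProbabilityMeasure P₂] (hP₁ : Integrable (fun x : ℝ≥0 => (x : ℝ)) P₁) {n m : ℕ → ℕ}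
    (hm : Tendsto m atTop atTop) (v : ∀ k, Fin (n k))
    (hr : Tendsto (fun k => (m k : ℝ) / n k) atTop (𝓝 0)) :
    Tendsto (fun k => (modelMeasure P₁ P₂ (n k) (m k)).real {ω | deg (v k) ω = 0}) atTop
      (𝓝 1) := by
  have hi : ∀ n m y, Integrable (fun x => (edgeProb n m x y : ℝ)) P₁ := fun n m y =>
    .of_bound (by fun_prop) 1 (.of_forall fun x => by
      rw [Real.norm_eq_abs, abs_of_nonneg (edgeProb_nonneg _ _ _ _)]
      exact edgeProb_le_one _ _ _ _)
  have hp0 : ∀ n m y, 0 ≤ ∫ x, (edgeProb n m x y : ℝ) ∂P₁ := fun n m y =>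
    integral_nonneg fun x => edgeProb_nonneg _ _ _ _
  have hp1 : ∀ n m y, ∫ x, (edgeProb n m x y : ℝ) ∂P₁ ≤ 1 := fun n m y => by
    simpa using integral_mono (hi n m y) (integrable_const 1) fun x => edgeProb_le_one n m x y
  have hmeas : ∀ n m, Measurable fun y => ∫ x, (edgeProb n m x y : ℝ) ∂P₁ := fun n m => by
    have h : Measurable fun a : ℝ≥0 × ℝ≥0 => (edgeProb n m a.2 a.1 : ℝ) := by fun_prop
    exact h.stronglyMeasurable.integral_prod_right'.measurable
  have hlow : Tendsto (fun k => ∫ y, (1 - ∫ x, (edgeProb (n k) (m k) x y : ℝ) ∂P₁) ^ m k ∂P₂)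
      atTop (𝓝 (∫ _, (1 : ℝ) ∂P₂)) := by
    refine tendsto_integral_of_dominated_convergence (fun _ => 1)
      (fun k => ((measurable_const.sub (hmeas _ _)).pow_const _).aestronglyMeasurable)
      (integrable_const 1) (fun k => .of_forall fun y => ?_) (.of_forall fun y => ?_)
    · rw [Real.norm_eq_abs, abs_of_nonneg (pow_nonneg (sub_nonneg.2 (hp1 _ _ _)) _)]
      exact pow_le_one₀ (sub_nonneg.2 (hp1 _ _ _)) (by linarith [hp0 (n k) (m k) y])
    · suffices h : Tendsto (fun k => m k * ∫ x, (edgeProb (n k) (m k) x y : ℝ) ∂P₁) atTop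
          (𝓝 0) by
        simpa using tendsto_one_sub_pow_exp hm (fun k => hp0 _ _ _) (fun k => hp1 _ _ _) h
      have hs : Tendsto (fun k => √((m k : ℝ) / n k) * (rawMoment P₁ 1 * y)) atTop (𝓝 0) := by
        simpa using hr.sqrt.mul_const (rawMoment P₁ 1 * y)
      refine squeeze_zero (fun k => mul_nonneg (Nat.cast_nonneg _) (hp0 _ _ _)) (fun k => ?_) hs
      rw [← div_sqrt_mul_eq _ _ (v k).pos, rawMoment, ← integral_mul_const, ← integral_const_mul,
        ← integral_const_mul]
      simp only [pow_one]
      refine integral_mono ((hi _ _ _).const_mul _) ((hP₁.mul_const _).const_mul _) fun x => ?_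
      refine (mul_le_mul_of_nonneg_left (edgeProb_le _ _ x y) (Nat.cast_nonneg _)).trans_eq ?_
      ring
  have h1 : ∫ _, (1 : ℝ) ∂P₂ = 1 := by simp
  rw [h1] at hlow
  exact tendsto_of_tendsto_of_tendsto_of_le_of_le hlow tendsto_const_nhds
    (fun k => integral_pow_le_prob_deg_eq_zero P₁ P₂ (v k)) fun k => measureReal_le_one

/-! ### The compound Poisson limit and the conclusion -/

/-- The generating function of the compound Poisson limit. -/
theorem integral_pow_compound {Ω : Type*} [MeasurableSpace Ω] (μ : Measure Ω)
    [IsProbabilityMeasure μ] (P₁ P₂ : Measure ℝ≥0) [IsProbabilityMeasure P₁]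
    [IsProbabilityMeasure P₂] (hP₁ : Integrable (fun x : ℝ≥0 => (x : ℝ)) P₁)
    (hP₂ : Integrable (fun y : ℝ≥0 => (y : ℝ)) P₂) {β : ℝ} (hβ : 0 < β)
    {Λ₁ Λ₂ : Ω → ℕ} {τ : ℕ → Ω → ℕ}
    (hΛ₁ : IsMixedPoisson μ Λ₁ P₂ (fun y => y * rawMoment P₁ 1 * √β))
    (hΛ₂ : IsMixedPoisson μ Λ₂ P₁ (fun x => x * rawMoment P₂ 1 * (√β)⁻¹))
    (hτ : ∀ j, IsSizeBiasedShift μ (τ j) Λ₂) (hind : iIndepFun τ μ)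
    (hid : ∀ j, IdentDistrib (τ j) (τ 0) μ μ) (hτΛ : IndepFun (fun ω j => τ j ω) Λ₁ μ)
    {z : ℝ} (hz0 : 0 ≤ z) (hz1 : z ≤ 1) :
    ∫ ω, z ^ (∑ j ∈ Finset.range (Λ₁ ω), τ j ω) ∂μ =
      ∫ y : ℝ≥0, Real.exp (-∫ x : ℝ≥0, (x : ℝ) * y * (√β *
        (1 - Real.exp (-((1 - z) * rawMoment P₂ 1 * (√β)⁻¹ * x)))) ∂P₁) ∂P₂ := by
  set a := rawMoment P₁ 1 with ha
  set b := rawMoment P₂ 1 with hb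
  set w := ∫ ω, z ^ τ 0 ω ∂μ with hw
  have ha' : a = ∫ x : ℝ≥0, (x : ℝ) ∂P₁ := by simp [ha, rawMoment]
  have hb' : b = ∫ y : ℝ≥0, (y : ℝ) ∂P₂ := by simp [hb, rawMoment]
  have ha0 : 0 ≤ a := integral_nonneg fun y => by positivity
  have hb0 : 0 ≤ b := integral_nonneg fun y => by positivity
  have hsβ : 0 < √β := Real.sqrt_pos.2 hβ
  have hw0 : 0 ≤ w := integral_nonneg fun ω => pow_nonneg hz0 _
  have hpow : Measurable fun j : ℕ => z ^ j := measurable_of_countable _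
  have hw1 : w ≤ 1 := by
    have hi : Integrable (fun ω => z ^ τ 0 ω) μ :=
      .of_bound (hpow.comp (hτ 0).measurable).aestronglyMeasurable 1 (.of_forall fun ω => by
        rw [Real.norm_eq_abs, abs_of_nonneg (pow_nonneg hz0 _)]
        exact pow_le_one₀ hz0 hz1)
    simpa using integral_mono hi (integrable_const 1) fun ω => pow_le_one₀ hz0 hz1
  -- The random sum and the mixed Poisson law lead to the same power series in w, so their sums
  -- agree: the left side is the generating function of Λ₁ at w.
  rw [(hasSum_integral_pow_random_sum μ hΛ₁.measurable (fun j => (hτ j).measurable) hind hid hτΛ hz0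
    hz1).unique (hΛ₁.hasSum_prob_mul_pow (by fun_prop) (fun y => by positivity) hw0 hw1)]
  set J := ∫ x : ℝ≥0, (x : ℝ) * Real.exp (-((1 - z) * (x * b * (√β)⁻¹))) ∂P₁ with hJ
  have hJle : ∀ x : ℝ≥0, (x : ℝ) * Real.exp (-((1 - z) * (x * b * (√β)⁻¹))) ≤ x := fun x => by
    refine mul_le_of_le_one_right (NNReal.coe_nonneg x) (Real.exp_le_one_iff.2 ?_)
    have : 0 ≤ (1 - z) * (x * b * (√β)⁻¹) := mul_nonneg (sub_nonneg.2 hz1) (by positivity)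
    linarith
  have hJi : Integrable (fun x : ℝ≥0 => (x : ℝ) * Real.exp (-((1 - z) * (x * b * (√β)⁻¹)))) P₁ :=
    hP₁.mono' (by fun_prop) (.of_forall fun x => by
      rw [Real.norm_eq_abs, abs_of_nonneg (by positivity)]
      exact hJle x)
  have hexp : ∀ y : ℝ≥0, ∫ x : ℝ≥0, (x : ℝ) * y * (√β *
      (1 - Real.exp (-((1 - z) * b * (√β)⁻¹ * x)))) ∂P₁ = y * √β * (a - J) := by
    intro y
    rw [ha', hJ, ← integral_sub hP₁ hJi, ← integral_const_mul]
    refine integral_congr_ae (.of_forall fun x => ?_)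
    simp only []
    rw [show (1 - z) * b * (√β)⁻¹ * (x : ℝ) = (1 - z) * (x * b * (√β)⁻¹) by ring]
    ring
  simp_rw [hexp]
  -- If b = 0, the law of τ is arbitrary, but Y = 0 almost surely and both exponents vanish.
  rcases hb0.eq_or_lt with hb00 | hbpos
  · have hy : ∀ᵐ y : ℝ≥0 ∂P₂, (y : ℝ) = 0 := by
      have h := (integral_eq_zero_iff_of_nonneg (fun y : ℝ≥0 => NNReal.coe_nonneg y) hP₂).1
        (hb'.symm.trans hb00.symm)
      filter_upwards [h] with y hy using hy
    refine integral_congr_ae ?_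
    filter_upwards [hy] with y hy
    simp [hy]
  -- The exponents are (1 - w) y a √β and y √β (a - J). For a > 0 the identity is the size-biasing
  -- formula with the factor b/√β cancelled; for a = 0 it holds because 0 ≤ J ≤ a.
  · suffices h : w * a = J by
      refine integral_congr_ae (.of_forall fun y => ?_)
      simp only [← h, ← hw]
      ring_nf
    rcases ha0.eq_or_lt with ha00 | hapos
    · have h1 : J ≤ a := by rw [ha', hJ]; exact integral_mono hJi hP₁ hJle
      have h2 : 0 ≤ J := integral_nonneg fun x => by positivity
      rw [← ha00] at h1 ⊢
      linarith
    · have hE : ∫ x : ℝ≥0, (x : ℝ) * b * (√β)⁻¹ ∂P₁ = a * (b * (√β)⁻¹) := by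
        simp_rw [mul_assoc]
        rw [integral_mul_const, ← ha']
      have hne : ∫ x : ℝ≥0, (x : ℝ) * b * (√β)⁻¹ ∂P₁ ≠ 0 := by
        rw [hE]; positivity
      have h := (hτ 0).integral_mul_integral_pow hΛ₂ (by fun_prop) (fun x => by positivity)
        ((hP₁.mul_const _).mul_const _) hne hz0 hz1
      have hr : ∫ x : ℝ≥0, (x : ℝ) * b * (√β)⁻¹ * Real.exp (-((1 - z) * (x * b * (√β)⁻¹))) ∂P₁ =
          (b * (√β)⁻¹) * J := by
        rw [hJ, ← integral_const_mul]
        refine integral_congr_ae (.of_forall fun x => ?_)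
        simp only []
        ring
      rw [hE, hr] at h
      have hc : 0 < b * (√β)⁻¹ := by positivity
      refine mul_left_cancel₀ hc.ne' ?_
      linarith

theorem integrable_of_integrable_sq (P : Measure ℝ≥0) [IsProbabilityMeasure P]
    (hP : Integrable (fun x : ℝ≥0 => (x : ℝ) ^ 2) P) : Integrable (fun x : ℝ≥0 => (x : ℝ)) P :=
  ((integrable_const 1).add hP).mono' (by fun_prop) (.of_forall fun x => by
    rw [Real.norm_eq_abs, abs_of_nonneg (NNReal.coe_nonneg x), Pi.add_apply]
    nlinarith [sq_nonneg ((x : ℝ) - 1)])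

end InhomRIG

end

theorem theorem1 (P₁ P₂ : Measure ℝ≥0) [IsProbabilityMeasure P₁] [IsProbabilityMeasure P₂]
    (n m : ℕ → ℕ) (hpos : ∀ k, 0 < n k)
    (hn : Tendsto n atTop atTop) (hm : Tendsto m atTop atTop) :
    -- (i)
    (Tendsto (fun k => (m k : ℝ) / n k) atTop (𝓝 0) →
      Integrable (fun x : ℝ≥0 => (x : ℝ)) P₁ →
      Tendsto (fun k => (InhomRIG.modelMeasure P₁ P₂ (n k) (m k)).real
        {ω | InhomRIG.deg ⟨0, hpos k⟩ ω = 0}) atTop (𝓝 1)) ∧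
    -- (ii)
    (∀ β : ℝ, 0 < β → Tendsto (fun k => (m k : ℝ) / n k) atTop (𝓝 β) →
      Integrable (fun x : ℝ≥0 => (x : ℝ) ^ 2) P₁ → Integrable (fun y : ℝ≥0 => (y : ℝ)) P₂ →
      ∀ (Ω : Type*) [MeasurableSpace Ω] (μ : Measure Ω) [IsProbabilityMeasure μ]
        (Λ₁ Λ₂ : Ω → ℕ) (τ : ℕ → Ω → ℕ),
        InhomRIG.IsMixedPoisson μ Λ₁ P₂ (fun y => y * InhomRIG.rawMoment P₁ 1 * √β) →
        InhomRIG.IsMixedPoisson μ Λ₂ P₁ (fun x => x * InhomRIG.rawMoment P₂ 1 * (√β)⁻¹) →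
        (∀ j, InhomRIG.IsSizeBiasedShift μ (τ j) Λ₂) →
        iIndepFun τ μ → (∀ j, IdentDistrib (τ j) (τ 0) μ μ) →
        IndepFun (fun ω j => τ j ω) Λ₁ μ →
        TendstoInDistribution (fun k => InhomRIG.deg (n := n k) (m := m k) ⟨0, hpos k⟩) atTop
          (fun ω => ∑ j ∈ Finset.range (Λ₁ ω), τ j ω)
          (fun k => InhomRIG.modelMeasure P₁ P₂ (n k) (m k)) μ) ∧
    -- (iii)
    (Tendsto (fun k => (m k : ℝ) / n k) atTop atTop →
      Integrable (fun x : ℝ≥0 => (x : ℝ) ^ 2) P₁ → Integrable (fun y : ℝ≥0 => (y : ℝ)) P₂ →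
      ∀ (Ω : Type*) [MeasurableSpace Ω] (μ : Measure Ω) [IsProbabilityMeasure μ] (Λ₃ : Ω → ℕ),
        InhomRIG.IsMixedPoisson μ Λ₃ P₂
          (fun y => y * InhomRIG.rawMoment P₁ 2 * InhomRIG.rawMoment P₂ 1) →
        TendstoInDistribution (fun k => InhomRIG.deg (n := n k) (m := m k) ⟨0, hpos k⟩) atTop
          Λ₃ (fun k => InhomRIG.modelMeasure P₁ P₂ (n k) (m k)) μ) := by

  refine ⟨fun hr hP₁ => ?_, ?_, ?_⟩
  · exact InhomRIG.tendsto_prob_deg_eq_zero P₁ P₂ hP₁ hm (fun k => ⟨0, hpos k⟩) hr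
  · intro β hβ hr hP₁ hP₂ Ω _ μ _ Λ₁ Λ₂ τ hΛ₁ hΛ₂ hτ hind hid hτΛ
    refine InhomRIG.tendstoInDistribution_of_tendsto_pgf _ μ
      (fun k => InhomRIG.measurable_deg _)
      (InhomRIG.measurable_random_sum hΛ₁.measurable fun j => (hτ j).measurable) fun z hz0 hz1 => ?_
    rw [InhomRIG.integral_pow_compound μ P₁ P₂ (InhomRIG.integrable_of_integrable_sq P₁ hP₁) hP₂
      hβ hΛ₁ hΛ₂ hτ hind hid hτΛ hz0 hz1]
    exact InhomRIG.tendsto_integral_pow_deg_of_ratio P₁ P₂ hP₁ hP₂ hn hm _ hβ hr hz0 hz1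
  · intro hr hP₁ hP₂ Ω _ μ _ Λ₃ hΛ₃
    have ha : 0 ≤ InhomRIG.rawMoment P₁ 2 := integral_nonneg fun x => by positivity
    have hb : 0 ≤ InhomRIG.rawMoment P₂ 1 := integral_nonneg fun y => by positivity
    refine InhomRIG.tendstoInDistribution_of_tendsto_pgf _ μ
      (fun k => InhomRIG.measurable_deg _) hΛ₃.measurable fun z hz0 hz1 => ?_
    rw [hΛ₃.integral_pow (by fun_prop) (fun y => by positivity) hz0 hz1]
    exact InhomRIG.tendsto_integral_pow_deg_of_ratio_atTop P₁ P₂ hP₁ hP₂ hn hm _ hr hz0 hz1
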